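/- \textbf{Setting.} Let $\mathcal X$ be a finite non-empty state space, $\mathcal A$ a measurable action space, $P$ a transition kernel from $\mathcal X\times\mathcal A$ to $\mathcal X$, $\pi$ a policy, $P^\pi(\cdot\mid x)=\int P(\cdot\mid x,a)\,\pi(\mathrm da\mid x)$, $\gamma\in(0,1)$, and $r:\mathcal X\to[0,R_{\max}]^d$ with $R_{\max}\ge 0$. For $x\in\mathcal X$ let $\eta^\pi(x)$ be the law of $\sum_{t\ge0}\gamma^t r(X_t)$, where $X_0=x$ and $X_{t+1}\sim P^\pi(\cdot\mid X_t)$. Let $\alpha\in(0,2)$, $y_0\in\mathbb R^d$, $\rho(x,y)=\|x-y\|_2^\alpha$ and $$\kappa(x,y)=\tfrac12\big(\rho(x,y_0)+\rho(y,y_0)-\rho(x,y)\big).$$ Let $\mathrm{MMD}$ be the associated maximum mean discrepancy (the RKHS distance of mean embeddings), i.e. $\mathrm{MMD}(p,q)^2=\mathbb E\,\kappa(Y,Y')-2\,\mathbb E\,\kappa(Y,Z)+\mathbb E\,\kappa(Z,Z')$ with independent $Y,Y'\sim p$ and $Z,Z'\sim q$, and let $\overline{\mathrm{MMD}}(\eta,\eta')=\max_{x\in\mathcal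 X}\mathrm{MMD}(\eta(x),\eta'(x))$. Let $m\ge1$, and for each $x$ let $\eta_0(x)$ be a probability measure on the space of returns $[0,R_{\max}/(1-\gamma)]^d$. Randomized dynamic programming with $m$ equally-weighted particles produces random return distribution functions $$\eta_{k+1}(x)=\frac1m\sum_{i=1}^m\delta_{r(x)+\gamma Z_{x,i}},\qquad X_{x,i}\sim P^\pi(\cdot\mid x),\quad Z_{x,i}\sim\eta_k(X_{x,i}),$$ with the pairs $(X_{x,i},Z_{x,i})$, $x\in\mathcal X$, $1\le i\le m$, drawn independently and afresh at every iteration. \textbf{Theorem.} There is a universal constant $C>0$ such that the following holds for all such data and every $\delta>0$. Put $K=\lceil\log m/\log\gamma^{-\alpha}\rceil$, $$B=\frac{d^{\alpha/2}R_{\max}^\alpha}{(1-\gamma)^\alpha},\qquad \Lambda=\frac{\max\{1,\ \log(|\mathcal X|\delta^{-1}/\log\gamma^{-\alpha})\}+\log m}{(1-\gamma^{\alpha/2})\sqrt m}.$$ Then, with probability at least $1-\delta$, the following three bounds hold simultaneously: \begin{enumerate} \item $\overline{\mathrm{MMD}}(\eta_K,\eta^\pi)\le C\,\sqrt{B}\,\Lambda$;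 \item if $\sqrt d\,R_{\max}\ge 1-\gamma$, then $\overline{\mathrm{MMD}}(\eta_K,\eta^\pi)\le C\,B\,\Lambda$, that is, $$\overline{\mathrm{MMD}}(\eta_K,\eta^\pi)\le C\,\frac{d^{\alpha/2}R_{\max}^\alpha}{(1-\gamma^{\alpha/2})(1-\gamma)^\alpha\sqrt m}\Big(\max\Big\{1,\log\frac{|\mathcal X|\delta^{-1}}{\log\gamma^{-\alpha}}\Big\}+\log m\Big);$$ \item $\overline{\mathrm{MMD}}(\eta_K,\eta^\pi)^2\le C\,B\,\Lambda$. \end{enumerate} -/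

import Mathlib

open MeasureTheory ProbabilityTheory
open scoped ENNReal

noncomputable section

namespace MultiReturn

/-! ### Semimetrics, induced kernels, maximum mean discrepancies -/

/-- The kernel induced by a semimetric `ρ` with base point `y₀`. -/
def inducedKernel {E : Type*} (ρ : E → E → ℝ) (y₀ : E) (y₁ y₂ : E) : ℝ :=
  (1 / 2) * (ρ y₁ y₀ + ρ y₂ y₀ - ρ y₁ y₂)

/-- The semimetric `ρ_α(y₁, y₂) = ‖y₁ - y₂‖₂ ^ α` on `ℝ^d`. -/
def energySemimetric {d : ℕ} (α : ℝ) (y₁ y₂ : EuclideanSpace ℝ (Fin d)) : ℝ :=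
  ‖y₁ - y₂‖ ^ α

/-- The maximum mean discrepancy, i.e. the RKHS distance between the mean embeddings:
`MMD(p, q)² = E κ(Y₁, Y₂) - 2 E κ(Y, Z) + E κ(Z₁, Z₂)` with independent `Y`'s of law `p`
and `Z`'s of law `q`. -/
def mmd {E : Type*} [MeasurableSpace E] (κ : E → E → ℝ) (p q : Measure E) : ℝ :=
  √((∫ w, κ w.1 w.2 ∂(p.prod p)) - 2 * (∫ w, κ w.1 w.2 ∂(p.prod q))
    + ∫ w, κ w.1 w.2 ∂(q.prod q))

/-- The supremal maximum mean discrepancy between two return distribution functions. -/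
def supMMD {X E : Type*} [MeasurableSpace E] (κ : E → E → ℝ) (η₁ η₂ : X → Measure E) : ℝ :=
  ⨆ x, mmd κ (η₁ x) (η₂ x)

/-! ### Policy-conditioned transitions and the multi-return distribution function -/

section MDP

variable {X A : Type*} [MeasurableSpace X] [MeasurableSpace A]

/-- The policy-conditioned transition kernel `P^π(· | x) = ∫ P(· | x, a) π(da | x)`. -/
def policyKernel (P : Kernel (X × A) X) (π : Kernel X A) : Kernel X X :=
  P ∘ₖ (Kernel.id ×ₖ π)

instance (P : Kernel (X × A) X) (π : Kernel X A) [IsMarkovKernel P] [IsMarkovKernel π] :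
    IsMarkovKernel (policyKernel P π) := by
  unfold policyKernel; infer_instance

theorem policyKernel_apply (P : Kernel (X × A) X) (π : Kernel X A) [IsMarkovKernel π]
    (x : X) {s : Set X} (hs : MeasurableSet s) :
    policyKernel P π x s = ∫⁻ a, P (x, a) s ∂(π x) := by
  have hm : Measurable fun b : X × A => P b s := P.measurable_coe hs
  rw [policyKernel, Kernel.comp_apply' _ _ _ hs, Kernel.lintegral_id_prod hm]

/-- The law of the trajectory `(X_t)` with `X_0 = x` and `X_{t+1} ∼ Q(· | X_t)`
(Ionescu-Tulcea). -/
def trajectoryLaw (Q : Kernel X X) [IsMarkovKernel Q] (x : X) : Measure (ℕ → X) :=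
  Kernel.traj (X := fun _ => X)
    (fun n => Q.comap (fun h : (i : Finset.Iic n) → X => h ⟨n, Finset.mem_Iic.2 le_rfl⟩)
      (measurable_pi_apply _)) 0 (fun _ => x)

/-- The discounted multi-return `∑ₜ γᵗ r(X_t)` of a trajectory. -/
def discountedReturn {d : ℕ} (r : X → EuclideanSpace ℝ (Fin d)) (γ : ℝ) (ω : ℕ → X) :
    EuclideanSpace ℝ (Fin d) :=
  ∑' t : ℕ, γ ^ t • r (ω t)

/-- The multi-return distribution function `η^π(x) = Law(G^π(x))`. -/
def returnDistribution {d : ℕ} (Q : Kernel X X) [IsMarkovKernel Q]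
    (r : X → EuclideanSpace ℝ (Fin d)) (γ : ℝ) (x : X) : Measure (EuclideanSpace ℝ (Fin d)) :=
  (trajectoryLaw Q x).map (discountedReturn r γ)

end MDP

/-- The cube `[0, R / (1 - γ)]^d`, in which all returns lie. -/
def returnSpace (d : ℕ) (R γ : ℝ) : Set (EuclideanSpace ℝ (Fin d)) :=
  {z | ∀ i, 0 ≤ z i ∧ z i ≤ R / (1 - γ)}

/-! ### Randomized dynamic programming with equally-weighted particles -/

/-- The equally-weighted particle measure `(1/m) ∑ᵢ δ_{θᵢ}`. -/
def ewp {d : ℕ} (m : ℕ) [NeZero m] (θ : Fin m → EuclideanSpace ℝ (Fin d)) :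
    ProbabilityMeasure (EuclideanSpace ℝ (Fin d)) :=
  ⟨(m : ℝ≥0∞)⁻¹ • ∑ i, Measure.dirac (θ i), ⟨by
    simp [ENNReal.inv_mul_cancel (Nat.cast_ne_zero.2 (NeZero.ne m)) (ENNReal.natCast_ne_top m)]⟩⟩

theorem measurable_ewp {d : ℕ} (m : ℕ) [NeZero m] : Measurable (ewp (d := d) m) := by
  refine Measurable.subtype_mk (Measure.measurable_of_measurable_coe _ fun s hs => ?_)
  simp only [Measure.smul_apply, Measure.finsetSum_apply, smul_eq_mul]
  refine Measurable.const_mul (Finset.measurable_sum _ fun i _ => ?_) _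
  simp only [Measure.dirac_apply' _ hs]
  exact (measurable_one.indicator hs).comp (measurable_pi_apply i)

theorem measurable_measure_pi {ι Ω : Type*} [Fintype ι] [MeasurableSpace Ω] {β : ι → Type*}
    [∀ i, MeasurableSpace (β i)] {μ : Ω → (i : ι) → Measure (β i)}
    [∀ a i, IsProbabilityMeasure (μ a i)] (h : ∀ i, Measurable fun a => μ a i) :
    Measurable fun a => Measure.pi (μ a) := by
  refine Measurable.measure_of_isPiSystem_of_isProbabilityMeasure generateFrom_pi.symm
    isPiSystem_pi ?_
  rintro _ ⟨s, hs, rfl⟩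
  simp only [Measure.pi_pi]
  exact Finset.measurable_prod _ fun i _ =>
    (Measure.measurable_coe (hs i (Set.mem_univ i))).comp (h i)

theorem measurable_particleUpdate {X : Type*} [MeasurableSpace X] {d : ℕ}
    (r : X → EuclideanSpace ℝ (Fin d)) (γ : ℝ) (m : ℕ) [NeZero m] :
    Measurable fun (ω : X → Fin m → X × EuclideanSpace ℝ (Fin d)) (x : X) =>
      ewp m fun i => r x + γ • (ω x i).2 :=
  measurable_pi_lambda _ fun x => (measurable_ewp m).comp <| measurable_pi_lambda _ fun i => by
    fun_prop

section Algorithm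

variable {X : Type*} [Fintype X] [MeasurableSpace X] [MeasurableSingletonClass X] {d : ℕ}

/-- A return distribution function on a finite state space, seen as a kernel. -/
def rdfKernel (η : X → ProbabilityMeasure (EuclideanSpace ℝ (Fin d))) :
    Kernel X (EuclideanSpace ℝ (Fin d)) :=
  ⟨fun x => (η x : Measure (EuclideanSpace ℝ (Fin d))), measurable_of_finite _⟩

instance (η : X → ProbabilityMeasure (EuclideanSpace ℝ (Fin d))) :
    IsMarkovKernel (rdfKernel η) :=
  ⟨fun x => (η x).2⟩

/-- The joint law of a sample `(X', Z)` with `X' ∼ Q(· | x)` and `Z ∼ η(X')` given `X'`. -/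
def sampleLaw (Q : Kernel X X) (x : X)
    (η : X → ProbabilityMeasure (EuclideanSpace ℝ (Fin d))) :
    Measure (X × EuclideanSpace ℝ (Fin d)) :=
  (Q x) ⊗ₘ (rdfKernel η)

instance (Q : Kernel X X) [IsMarkovKernel Q] (x : X)
    (η : X → ProbabilityMeasure (EuclideanSpace ℝ (Fin d))) :
    IsProbabilityMeasure (sampleLaw Q x η) := by
  unfold sampleLaw; infer_instance

theorem measurable_sampleLaw (Q : Kernel X X) [IsMarkovKernel Q] (x : X) :
    Measurable (sampleLaw (d := d) Q x) := by
  refine Measure.measurable_of_measurable_coe _ fun s hs => ?_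
  have : ∀ η : X → ProbabilityMeasure (EuclideanSpace ℝ (Fin d)), sampleLaw Q x η s =
      ∑ x', (η x' : Measure (EuclideanSpace ℝ (Fin d))) (Prod.mk x' ⁻¹' s) * Q x {x'} := by
    intro η
    rw [sampleLaw, Measure.compProd_apply hs, lintegral_fintype]
    rfl
  simp only [this]
  refine Finset.measurable_sum _ fun x' _ => Measurable.mul_const ?_ _
  exact (Measure.measurable_coe (measurable_prodMk_left hs)).comp
    (measurable_subtype_coe.comp (measurable_pi_apply x'))

/-- One step of randomized dynamic programming, as a Markov kernel on return distribution
functions: `η` is sent to the law of `x ↦ (1/m) ∑ᵢ δ_{r(x) + γ Z_{x,i}}`, where the pairs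
`(X_{x,i}, Z_{x,i})`, for `x` a state and `i = 1, …, m`, are independent, with
`X_{x,i} ∼ Q(· | x)` and `Z_{x,i} ∼ η(X_{x,i})` given `X_{x,i}`. -/
def randBellman (Q : Kernel X X) [IsMarkovKernel Q] (r : X → EuclideanSpace ℝ (Fin d)) (γ : ℝ)
    (m : ℕ) [NeZero m] :
    Kernel (X → ProbabilityMeasure (EuclideanSpace ℝ (Fin d)))
      (X → ProbabilityMeasure (EuclideanSpace ℝ (Fin d))) :=
  Kernel.map
    ⟨fun η => Measure.pi fun x : X => Measure.pi fun _ : Fin m => sampleLaw Q x η,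
      measurable_measure_pi fun x => measurable_measure_pi fun _ => measurable_sampleLaw Q x⟩
    (fun ω x => ewp m fun i => r x + γ • (ω x i).2)

theorem randBellman_apply (Q : Kernel X X) [IsMarkovKernel Q] (r : X → EuclideanSpace ℝ (Fin d))
    (γ : ℝ) (m : ℕ) [NeZero m] (η : X → ProbabilityMeasure (EuclideanSpace ℝ (Fin d))) :
    randBellman Q r γ m η =
      (Measure.pi fun x : X => Measure.pi fun _ : Fin m => sampleLaw Q x η).map
        (fun ω x => ewp m fun i => r x + γ • (ω x i).2) :=
  Kernel.map_apply _ (measurable_particleUpdate r γ m) _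

instance (Q : Kernel X X) [IsMarkovKernel Q] (r : X → EuclideanSpace ℝ (Fin d)) (γ : ℝ)
    (m : ℕ) [NeZero m] : IsMarkovKernel (randBellman Q r γ m) :=
  ⟨fun η => by
    rw [randBellman_apply]
    exact Measure.isProbabilityMeasure_map (measurable_particleUpdate r γ m).aemeasurable⟩

/-- The law of the `k`-th iterate `η_k` of randomized dynamic programming started at `η₀`;
each iteration uses fresh samples. -/
def iterateLaw (Q : Kernel X X) [IsMarkovKernel Q] (r : X → EuclideanSpace ℝ (Fin d)) (γ : ℝ)
    (m : ℕ) [NeZero m] (η₀ : X → ProbabilityMeasure (EuclideanSpace ℝ (Fin d))) :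
    ℕ → Measure (X → ProbabilityMeasure (EuclideanSpace ℝ (Fin d)))
  | 0 => Measure.dirac η₀
  | k + 1 => (iterateLaw Q r γ m η₀ k).bind (randBellman Q r γ m)

instance (Q : Kernel X X) [IsMarkovKernel Q] (r : X → EuclideanSpace ℝ (Fin d)) (γ : ℝ)
    (m : ℕ) [NeZero m] (η₀ : X → ProbabilityMeasure (EuclideanSpace ℝ (Fin d))) (k : ℕ) :
    IsProbabilityMeasure (iterateLaw Q r γ m η₀ k) := by
  induction k with
  | zero => unfold iterateLaw; infer_instance
  | succ k ih => unfold iterateLaw; infer_instance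

end Algorithm

/-! ### Quantities in the error bound -/

/-- The scale `d^{α/2} R^α / (1 - γ)^α`. -/
def returnScale (d : ℕ) (R γ α : ℝ) : ℝ :=
  (d : ℝ) ^ (α / 2) * R ^ α / (1 - γ) ^ α

/-- The number of iterations `K = ⌈log m / log γ^{-α}⌉`. -/
def numIterations (m : ℕ) (γ α : ℝ) : ℕ :=
  ⌈Real.log m / Real.log (γ ^ (-α))⌉₊

/-- The factor
`(max {1, log (N δ⁻¹ / log γ^{-α})} + log m) / ((1 - γ^{α/2}) √m)`, with `N` states. -/
def errorFactor (N m : ℕ) (γ α δ : ℝ) : ℝ :=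
  (max 1 (Real.log (N * δ⁻¹ / Real.log (γ ^ (-α)))) + Real.log m) /
    ((1 - γ ^ (α / 2)) * √m)

end MultiReturn

end

open MultiReturn

noncomputable section

namespace MultiReturn

section FeatureMap

open Set

/-! ### A Hilbert space feature map for the energy semimetric -/

/-! For `0 < α < 2` the function `‖x - y‖ ^ α` is a squared Hilbert distance: there is a map `Φ`
with `‖Φ x - Φ y‖² = ‖x - y‖ ^ α` whose Gram kernel is `κ` (`exists_feature_inner`). Hence the MMD
is the distance between the mean embeddings `∫ Φ dp` and `∫ Φ dq` (`mmd_eq_norm_sub`), and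
everything happens in a Hilbert space.

Scaling returns by `γ` multiplies squared feature distances by `γ ^ α`. The distributional Bellman
operator therefore contracts the supremal MMD by `β = γ ^ (α / 2)` (`norm_integral_bellman_sub_le`),
and `η^π` is its fixed point (`returnDistribution_eq_sum`, from the Markov property). Given `η_k`,
the next particles at `x` are independent draws from the Bellman image of `η_k`, so the sampling
error is an average of `m` independent centred vectors of norm at most `√(γ ^ α B)`. A
dimension-free subgaussian bound (`measure_norm_sum_ge_le`) and a union bound over states keep it
below `ε`, except with probability `2 |X| exp(-ε² m / (4 γ ^ α B))`.

After `K` steps the error is at most `β ^ K √B + ε / (1 - β)`, with failure probability `K` times as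
large (`iterateLaw_closeRDF_compl_le`). The chosen `K` makes `β ^ K ≤ 1 / √m`, and `ε` is tuned to
total failure probability `δ`. This gives the bound with `√B`; the other two follow from `√B ≤ B`
when `B ≥ 1`, and from the deterministic bound `M ≤ √B` on the supremal error `M`. -/

theorem norm_exp_mul_I_sub_one_sq (θ : ℝ) :
    ‖Complex.exp (θ * Complex.I) - 1‖ ^ 2 = 2 * (1 - Real.cos θ) := by
  rw [← Complex.normSq_eq_norm_sq, Complex.normSq_apply]
  simp only [Complex.sub_re, Complex.exp_ofReal_mul_I_re, Complex.one_re, Complex.sub_im,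
    Complex.exp_ofReal_mul_I_im, Complex.one_im]
  nlinarith [Real.sin_sq_add_cos_sq θ]

theorem norm_exp_mul_I_sub_exp_mul_I (a b : ℝ) :
    ‖Complex.exp (a * Complex.I) - Complex.exp (b * Complex.I)‖ =
      ‖Complex.exp ((a - b : ℝ) * Complex.I) - 1‖ := by
  have : Complex.exp (a * Complex.I) - Complex.exp (b * Complex.I) =
      Complex.exp (b * Complex.I) * (Complex.exp ((a - b : ℝ) * Complex.I) - 1) := by
    rw [mul_sub, ← Complex.exp_add, mul_one]
    congr 2
    push_cast
    ring
  rw [this, norm_mul, Complex.norm_exp_ofReal_mul_I, one_mul]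

section FourierFeature

variable {E : Type*} [NormedAddCommGroup E] [InnerProductSpace ℝ E]

/-- The weighted random Fourier feature of a point. -/
def fourierFeature (α : ℝ) (x : E) (p : ℝ × E) : ℂ :=
  ((p.1 ^ (-(1 + α) / 2) : ℝ) : ℂ) *
    (Complex.exp ((p.1 * inner ℝ p.2 x : ℝ) * Complex.I) - 1)

theorem norm_fourierFeature_sub_sq {α : ℝ} (x y : E) {t : ℝ} (ht : 0 < t) (g : E) :
    ‖fourierFeature α x (t, g) - fourierFeature α y (t, g)‖ ^ 2 = t ^ (-(1 + α)) *
      ‖Complex.exp ((inner ℝ g (t • (x - y)) : ℝ) * Complex.I) - 1‖ ^ 2 := by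
  rw [fourierFeature, fourierFeature, ← mul_sub, sub_sub_sub_cancel_right, norm_mul,
    norm_exp_mul_I_sub_exp_mul_I, mul_pow, Complex.norm_real,
    Real.norm_of_nonneg (Real.rpow_nonneg ht.le _), ← Real.rpow_natCast (t ^ _),
    ← Real.rpow_mul ht.le,
    inner_smul_right, inner_sub_right, ← mul_sub]
  congr 2
  push_cast
  ring

end FourierFeature

section Feature

variable {E : Type*} [NormedAddCommGroup E] [InnerProductSpace ℝ E] [FiniteDimensional ℝ E]
  [MeasurableSpace E] [BorelSpace E]

theorem integral_cos_inner_stdGaussian (x : E) :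
    ∫ g, Real.cos (inner ℝ g x) ∂(stdGaussian E) = Real.exp (-‖x‖ ^ 2 / 2) := by
  have h := congrArg Complex.re (charFun_stdGaussian x)
  rw [charFun_apply] at h
  have hint : Integrable (fun g : E => Complex.exp ((inner ℝ g x : ℝ) * Complex.I))
      (stdGaussian E) := by
    refine Integrable.of_bound (by fun_prop) 1 (.of_forall fun g => ?_)
    rw [Complex.norm_exp_ofReal_mul_I]
  have h2 := integral_re hint
  simp only [RCLike.re_to_complex, Complex.exp_ofReal_mul_I_re] at h2
  rw [h2, h]
  norm_cast

theorem integral_norm_exp_inner_sub_one_sq (x : E) :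
    ∫ g, ‖Complex.exp ((inner ℝ g x : ℝ) * Complex.I) - 1‖ ^ 2 ∂(stdGaussian E) =
      2 * (1 - Real.exp (-‖x‖ ^ 2 / 2)) := by
  simp only [norm_exp_mul_I_sub_one_sq]
  rw [integral_const_mul, integral_sub (integrable_const _), integral_cos_inner_stdGaussian]
  · simp
  · refine Integrable.of_bound (by fun_prop) 1 (.of_forall fun g => ?_)
    exact Real.abs_cos_le_one _

/-- The radial density whose Mellin-type integral produces `s ^ α`. -/
def radialDensity (α t : ℝ) : ℝ := t ^ (-(1 + α)) * (2 * (1 - Real.exp (-t ^ 2 / 2)))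

theorem radialDensity_pos {α t : ℝ} (ht : 0 < t) : 0 < radialDensity α t := by
  have : Real.exp (-t ^ 2 / 2) < 1 := by
    rw [Real.exp_lt_one_iff]
    have := sq_pos_of_pos ht
    linarith
  have h2 := Real.rpow_pos_of_pos ht (-(1 + α))
  unfold radialDensity
  have : 0 < 1 - Real.exp (-t ^ 2 / 2) := by linarith
  positivity

theorem measurable_radialDensity (α : ℝ) : Measurable (radialDensity α) := by
  unfold radialDensity
  fun_prop

/-- Near `0` the bracket is at most `t²`, leaving `t ^ (1 - α)`, integrable because `α < 2`. On `(1,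
∞)` the bracket is at most `2`, leaving `t ^ (-(1 + α))`, integrable because `α > 0`. -/
theorem integrableOn_radialDensity {α : ℝ} (h0 : 0 < α) (h2 : α < 2) :
    IntegrableOn (radialDensity α) (Ioi 0) := by
  rw [← Ioc_union_Ioi_eq_Ioi (zero_le_one (α := ℝ))]
  refine IntegrableOn.union ?_ ?_
  · have hi : IntegrableOn (fun t : ℝ => t ^ (1 - α)) (Ioc 0 1) := by
      rw [← intervalIntegrable_iff_integrableOn_Ioc_of_le zero_le_one]
      exact intervalIntegral.intervalIntegrable_rpow' (by linarith)
    refine Integrable.mono' hi (measurable_radialDensity α).aestronglyMeasurable ?_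
    filter_upwards [ae_restrict_mem measurableSet_Ioc] with t ht
    rw [Real.norm_of_nonneg (radialDensity_pos ht.1).le]
    have e : t ^ (1 - α) = t ^ (-(1 + α)) * t ^ 2 := by
      rw [← Real.rpow_natCast, ← Real.rpow_add ht.1]
      congr 1
      push_cast
      ring
    rw [radialDensity, e]
    have := Real.add_one_le_exp (-t ^ 2 / 2)
    have := Real.rpow_nonneg ht.1.le (-(1 + α))
    gcongr
    linarith
  · have hi : IntegrableOn (fun t : ℝ => t ^ (-(1 + α)) * 2) (Ioi 1) :=
      (integrableOn_Ioi_rpow_of_lt (by linarith) one_pos).mul_const 2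
    refine Integrable.mono' hi (measurable_radialDensity α).aestronglyMeasurable ?_
    filter_upwards [ae_restrict_mem measurableSet_Ioi] with t ht
    have ht0 : (0 : ℝ) < t := one_pos.trans ht
    rw [Real.norm_of_nonneg (radialDensity_pos ht0).le, radialDensity]
    have := Real.exp_pos (-t ^ 2 / 2)
    have := Real.rpow_nonneg ht0.le (-(1 + α))
    gcongr
    linarith

theorem integral_radialDensity_pos {α : ℝ} (h0 : 0 < α) (h2 : α < 2) :
    0 < ∫ t in Ioi 0, radialDensity α t := by
  rw [setIntegral_pos_iff_support_of_nonneg_ae _ (integrableOn_radialDensity h0 h2)]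
  · have : Function.support (radialDensity α) ∩ Ioi 0 = Ioi 0 := by
      rw [inter_eq_right]
      exact fun t ht => (radialDensity_pos ht).ne'
    simp [this]
  · filter_upwards [ae_restrict_mem measurableSet_Ioi] with t ht
    exact (radialDensity_pos ht).le

theorem radialDensity_scale {α s t : ℝ} (hs : 0 < s) (ht : 0 < t) :
    t ^ (-(1 + α)) * (2 * (1 - Real.exp (-(t * s) ^ 2 / 2))) =
      s ^ (1 + α) * radialDensity α (s * t) := by
  rw [radialDensity, Real.mul_rpow hs.le ht.le, Real.rpow_neg hs.le, mul_comm t s]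
  have := (Real.rpow_pos_of_pos hs (1 + α)).ne'
  field_simp

theorem integrableOn_radialDensity_scale {α : ℝ} (h0 : 0 < α) (h2 : α < 2) {s : ℝ} (hs : 0 ≤ s) :
    IntegrableOn (fun t : ℝ => t ^ (-(1 + α)) * (2 * (1 - Real.exp (-(t * s) ^ 2 / 2))))
      (Ioi 0) := by
  rcases hs.eq_or_lt with rfl | hs
  · simp
  · have := (integrableOn_Ioi_comp_mul_left_iff (radialDensity α) 0 hs).2
      (by simpa using integrableOn_radialDensity h0 h2)
    refine IntegrableOn.congr_fun (this.const_mul (s ^ (1 + α))) (fun t ht => ?_)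
      measurableSet_Ioi
    exact (radialDensity_scale hs ht).symm

/-- The substitution `t ↦ s t` pulls out `s ^ α` by homogeneity. This is how the power of the
distance arises from Gaussian characteristic functions. -/
theorem integral_radialDensity_scale {α : ℝ} (h0 : 0 < α) {s : ℝ} (hs : 0 ≤ s) :
    ∫ t in Ioi 0, t ^ (-(1 + α)) * (2 * (1 - Real.exp (-(t * s) ^ 2 / 2))) =
      s ^ α * ∫ t in Ioi 0, radialDensity α t := by
  rcases hs.eq_or_lt with rfl | hs
  · simp [Real.zero_rpow h0.ne']
  · rw [setIntegral_congr_fun measurableSet_Ioi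
      (fun t ht => radialDensity_scale (α := α) hs ht), integral_const_mul,
      integral_comp_mul_left_Ioi (radialDensity α) 0 hs, Real.rpow_add hs, Real.rpow_one]
    simp only [mul_zero, smul_eq_mul]
    field_simp

/-- The measure on which the random Fourier features live. -/
def spectralMeasure (E : Type*) [NormedAddCommGroup E] [InnerProductSpace ℝ E]
    [FiniteDimensional ℝ E] [MeasurableSpace E] [BorelSpace E] : Measure (ℝ × E) :=
  (volume.restrict (Ioi 0)).prod (stdGaussian E)

theorem measurable_fourierFeature (α : ℝ) (x : E) : Measurable (fourierFeature α x) := by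
  unfold fourierFeature
  fun_prop

theorem integral_norm_fourierFeature_sub_sq {α : ℝ} (x y : E) {t : ℝ} (ht : 0 < t) :
    ∫ g, ‖fourierFeature α x (t, g) - fourierFeature α y (t, g)‖ ^ 2 ∂(stdGaussian E) =
      t ^ (-(1 + α)) * (2 * (1 - Real.exp (-(t * ‖x - y‖) ^ 2 / 2))) := by
  simp only [norm_fourierFeature_sub_sq x y ht]
  rw [integral_const_mul, integral_norm_exp_inner_sub_one_sq, norm_smul,
    Real.norm_of_nonneg ht.le]

theorem integrable_norm_fourierFeature_sub_sq {α : ℝ} (h0 : 0 < α) (h2 : α < 2) (x y : E) :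
    Integrable (fun p => ‖fourierFeature α x p - fourierFeature α y p‖ ^ 2)
      (spectralMeasure E) := by
  have hm : Measurable (fun p => ‖fourierFeature α x p - fourierFeature α y p‖ ^ 2) :=
    ((measurable_fourierFeature α x).sub (measurable_fourierFeature α y)).norm.pow_const 2
  rw [spectralMeasure, integrable_prod_iff hm.aestronglyMeasurable]
  constructor
  · filter_upwards [ae_restrict_mem measurableSet_Ioi] with t ht
    simp only [norm_fourierFeature_sub_sq x y ht]
    refine Integrable.const_mul ?_ _
    simp only [norm_exp_mul_I_sub_one_sq]
    refine Integrable.of_bound (by fun_prop) 4 (.of_forall fun g => ?_)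
    rw [Real.norm_eq_abs, abs_le]
    constructor <;>
      linarith [Real.neg_one_le_cos (inner ℝ g (t • (x - y))),
        Real.cos_le_one (inner ℝ g (t • (x - y)))]
  · refine (integrableOn_radialDensity_scale h0 h2 (norm_nonneg (x - y))).congr_fun
      (fun t ht => ?_) measurableSet_Ioi
    simp only [norm_pow, norm_norm]
    exact (integral_norm_fourierFeature_sub_sq x y ht).symm

theorem integral_spectralMeasure_norm_sub_sq {α : ℝ} (h0 : 0 < α) (h2 : α < 2) (x y : E) :
    ∫ p, ‖fourierFeature α x p - fourierFeature α y p‖ ^ 2 ∂(spectralMeasure E) =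
      ‖x - y‖ ^ α * ∫ t in Ioi 0, radialDensity α t := by
  have hi := integrable_norm_fourierFeature_sub_sq h0 h2 x y
  rw [spectralMeasure] at hi ⊢
  rw [integral_prod _ hi, ← integral_radialDensity_scale h0 (norm_nonneg (x - y))]
  exact setIntegral_congr_fun measurableSet_Ioi fun t ht =>
    integral_norm_fourierFeature_sub_sq x y ht

/-- The feature of the point `0` vanishes identically, so the squared norm of a feature is its
squared distance to the feature of `0`. -/
theorem memLp_fourierFeature {α : ℝ} (h0 : 0 < α) (h2 : α < 2) (x : E) :
    MemLp (fourierFeature α x) 2 (spectralMeasure E) := by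
  rw [memLp_two_iff_integrable_sq_norm (measurable_fourierFeature α x).aestronglyMeasurable]
  refine (integrable_norm_fourierFeature_sub_sq h0 h2 x 0).congr (.of_forall fun p => ?_)
  simp [fourierFeature]

theorem norm_toLp_fourierFeature_sub_sq {α : ℝ} (h0 : 0 < α) (h2 : α < 2) (x y : E) :
    ‖(memLp_fourierFeature h0 h2 x).toLp _ - (memLp_fourierFeature h0 h2 y).toLp _‖ ^ 2 =
      ‖x - y‖ ^ α * ∫ t in Ioi 0, radialDensity α t := by
  rw [← MemLp.toLp_sub, ← real_inner_self_eq_norm_sq, L2.inner_def,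
    ← integral_spectralMeasure_norm_sub_sq h0 h2]
  refine integral_congr_ae ?_
  filter_upwards [MemLp.coeFn_toLp
    ((memLp_fourierFeature h0 h2 x).sub (memLp_fourierFeature h0 h2 y))] with p hp
  rw [hp, real_inner_self_eq_norm_sq]
  rfl

/-- The Hilbert space of square integrable Fourier features. -/
abbrev FeatureSpace (E : Type*) [NormedAddCommGroup E] [InnerProductSpace ℝ E]
    [FiniteDimensional ℝ E] [MeasurableSpace E] [BorelSpace E] : Type _ :=
  Lp ℂ 2 (spectralMeasure E)

theorem exists_feature_norm_sub_sq {α : ℝ} (h0 : 0 < α) (h2 : α < 2) :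
    ∃ Φ : E → FeatureSpace E, ∀ x y, ‖Φ x - Φ y‖ ^ 2 = ‖x - y‖ ^ α := by
  have hc := integral_radialDensity_pos h0 h2
  refine ⟨fun x => (√(∫ t in Ioi 0, radialDensity α t))⁻¹ •
    (memLp_fourierFeature h0 h2 x).toLp _, fun x y => ?_⟩
  rw [← smul_sub, norm_smul, mul_pow, norm_toLp_fourierFeature_sub_sq h0 h2, norm_inv,
    Real.norm_of_nonneg (Real.sqrt_nonneg _), inv_pow, Real.sq_sqrt hc.le]
  field_simp

end Feature

theorem exists_feature_inner {d : ℕ} {α : ℝ} (h0 : 0 < α) (h2 : α < 2)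
    (y₀ : EuclideanSpace ℝ (Fin d)) :
    ∃ Φ : EuclideanSpace ℝ (Fin d) → FeatureSpace (EuclideanSpace ℝ (Fin d)), Continuous Φ ∧
      (∀ x y, inner ℝ (Φ x) (Φ y) = inducedKernel (energySemimetric α) y₀ x y) ∧
      ∀ x y, ‖Φ x - Φ y‖ ^ 2 = ‖x - y‖ ^ α := by
  obtain ⟨Φ, hΦ⟩ := exists_feature_norm_sub_sq (E := EuclideanSpace ℝ (Fin d)) h0 h2
  -- Translating by `Φ y₀` keeps all distances, and polarization around the new origin produces
  -- exactly the kernel with base point `y₀`.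
  refine ⟨fun x => Φ x - Φ y₀, ?_, fun x y => ?_, fun x y => ?_⟩
  · rw [continuous_iff_continuousAt]
    intro x
    rw [ContinuousAt, tendsto_iff_norm_sub_tendsto_zero]
    have : ∀ y, ‖Φ y - Φ y₀ - (Φ x - Φ y₀)‖ = √(‖y - x‖ ^ α) := fun y => by
      rw [sub_sub_sub_cancel_right, ← hΦ, Real.sqrt_sq (norm_nonneg _)]
    simp only [this]
    have hc : Continuous fun y : EuclideanSpace ℝ (Fin d) => √(‖y - x‖ ^ α) :=
      ((continuous_id.sub continuous_const).norm.rpow_const fun _ => Or.inr h0.le).sqrt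
    simpa [Real.zero_rpow h0.ne'] using hc.tendsto x
  · rw [real_inner_eq_norm_mul_self_add_norm_mul_self_sub_norm_sub_mul_self_div_two,
      sub_sub_sub_cancel_right, ← sq, ← sq, ← sq, hΦ, hΦ, hΦ, inducedKernel]
    simp only [energySemimetric]
    ring
  · rw [sub_sub_sub_cancel_right, hΦ]

end FeatureMap

/-! ### Concentration of sums of independent bounded vectors in a Hilbert space -/

section Concentration

variable {Ω H : Type*} [MeasurableSpace Ω] [NormedAddCommGroup H] [InnerProductSpace ℝ H]
  [CompleteSpace H] {μ : Measure Ω} [IsProbabilityMeasure μ] {V : Ω → H} {D : ℝ}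

/-- Hoeffding's lemma for the centred real variable `⟪u, V⟫`, which takes values in `[-‖u‖ D, ‖u‖
D]`. -/
theorem integral_exp_inner_le (hV : StronglyMeasurable V) (hD : 0 ≤ D)
    (hb : ∀ᵐ ω ∂μ, ‖V ω‖ ≤ D) (h0 : ∫ ω, V ω ∂μ = 0) (u : H) (t : ℝ) :
    Integrable (fun ω => Real.exp (t * inner ℝ u (V ω))) μ ∧
      ∫ ω, Real.exp (t * inner ℝ u (V ω)) ∂μ ≤ Real.exp (t ^ 2 * (‖u‖ * D) ^ 2 / 2) := by
  have hVi : Integrable V μ := Integrable.of_bound hV.aestronglyMeasurable D hb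
  have hsg := hasSubgaussianMGF_of_mem_Icc_of_integral_eq_zero (μ := μ)
    (X := fun ω => inner ℝ u (V ω)) (a := -(‖u‖ * D)) (b := ‖u‖ * D)
    (hVi.const_inner u).aemeasurable
    (by
      filter_upwards [hb] with ω hω
      refine abs_le.1 ?_
      exact (abs_real_inner_le_norm _ _).trans (by gcongr))
    (by rw [integral_inner hVi, h0, inner_zero_right])
  refine ⟨hsg.integrable_exp_mul t, (hsg.mgf_le t).trans (le_of_eq ?_)⟩
  have : 0 ≤ ‖u‖ * D := by positivity
  congr 1
  push_cast
  rw [Real.norm_of_nonneg (by linarith)]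
  ring

/-- Expand the square: `‖V‖²` is at most `D²`, and the cross term is handled by Hoeffding's lemma at
`2 θ`. -/
theorem lintegral_exp_norm_add_sq_le (hV : StronglyMeasurable V) (hD : 0 ≤ D)
    (hb : ∀ᵐ ω ∂μ, ‖V ω‖ ≤ D) (h0 : ∫ ω, V ω ∂μ = 0) (u : H) {θ : ℝ} (hθ : 0 ≤ θ) :
    ∫⁻ ω, ENNReal.ofReal (Real.exp (θ * ‖u + V ω‖ ^ 2)) ∂μ ≤
      ENNReal.ofReal (Real.exp (θ * D ^ 2) * Real.exp ((θ + 2 * θ ^ 2 * D ^ 2) * ‖u‖ ^ 2)) := by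
  obtain ⟨hi, hle⟩ := integral_exp_inner_le hV hD hb h0 u (2 * θ)
  calc ∫⁻ ω, ENNReal.ofReal (Real.exp (θ * ‖u + V ω‖ ^ 2)) ∂μ
      ≤ ∫⁻ ω, ENNReal.ofReal (Real.exp (θ * ‖u‖ ^ 2 + θ * D ^ 2) *
          Real.exp (2 * θ * inner ℝ u (V ω))) ∂μ := by
        refine lintegral_mono_ae ?_
        filter_upwards [hb] with ω hω
        refine ENNReal.ofReal_le_ofReal ?_
        rw [← Real.exp_add, Real.exp_le_exp, norm_add_sq_real]
        have : ‖V ω‖ ^ 2 ≤ D ^ 2 := by gcongr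
        nlinarith
    _ = ENNReal.ofReal (Real.exp (θ * ‖u‖ ^ 2 + θ * D ^ 2) *
          ∫ ω, Real.exp (2 * θ * inner ℝ u (V ω)) ∂μ) := by
        rw [← ofReal_integral_eq_lintegral_ofReal (hi.const_mul _)
          (.of_forall fun ω => by positivity), integral_const_mul]
    _ ≤ _ := by
        refine ENNReal.ofReal_le_ofReal ?_
        refine (mul_le_mul_of_nonneg_left hle (Real.exp_pos _).le).trans (le_of_eq ?_)
        rw [← Real.exp_add, ← Real.exp_add]
        congr 1
        ring

/-- The right-hand side is the exact value of `E exp(θ (‖u‖ + g)²)` for a centred real Gaussian `g`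
of variance `k D²`. This form reproduces itself when one more summand is added, and the dimension
never enters. The inductive step reduces to `exp(-q) ≥ 1 - q` and `1 + q ≤ 1 / (1 - q)`. -/
theorem lintegral_exp_norm_add_sum_sq_le (hV : StronglyMeasurable V) (hD : 0 ≤ D)
    (hb : ∀ᵐ ω ∂μ, ‖V ω‖ ≤ D) (h0 : ∫ ω, V ω ∂μ = 0) {θ : ℝ} (hθ : 0 ≤ θ) (k : ℕ)
    (hk : 2 * k * θ * D ^ 2 < 1) (u : H) :
    ∫⁻ z, ENNReal.ofReal (Real.exp (θ * ‖u + ∑ i, V (z i)‖ ^ 2))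
        ∂(Measure.pi fun _ : Fin k => μ) ≤
      ENNReal.ofReal ((√(1 - 2 * k * θ * D ^ 2))⁻¹ *
        Real.exp (θ / (1 - 2 * k * θ * D ^ 2) * ‖u‖ ^ 2)) := by
  induction k generalizing u with
  | zero => simp
  | succ k ih =>
    have hq : 0 ≤ θ * D ^ 2 := by positivity
    have hk' : 2 * k * θ * D ^ 2 + 2 * (θ * D ^ 2) < 1 := by
      push_cast at hk
      linarith
    have ha : 0 < 1 - 2 * k * θ * D ^ 2 := by linarith
    have hk0 : 2 * k * θ * D ^ 2 < 1 := by linarith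
    set a := 1 - 2 * k * θ * D ^ 2 with ha_def
    set θ' := θ / a with hθ'
    have hθ0 : 0 ≤ θ' := by positivity
    set q := 2 * θ' * D ^ 2 with hq_def
    have haq : a * (1 - q) = 1 - 2 * (k + 1 : ℕ) * θ * D ^ 2 := by
      have : a * θ' = θ := mul_div_cancel₀ _ ha.ne'
      rw [hq_def, show a * (1 - 2 * θ' * D ^ 2) = a - 2 * (a * θ') * D ^ 2 by ring, this, ha_def]
      push_cast
      ring
    have hq0 : 0 ≤ q := by positivity
    have hq1 : 0 < 1 - q := by
      have : 0 < a * (1 - q) := by rw [haq]; linarith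
      exact (pos_iff_pos_of_mul_pos this).1 ha
    have hF : Measurable fun z : Fin (k + 1) → Ω =>
        ENNReal.ofReal (Real.exp (θ * ‖u + ∑ i, V (z i)‖ ^ 2)) := by
      have : StronglyMeasurable fun z : Fin (k + 1) → Ω => u + ∑ i, V (z i) :=
        stronglyMeasurable_const.add (Finset.stronglyMeasurable_fun_sum _ fun i _ =>
          hV.comp_measurable (measurable_pi_apply i))
      have := this.norm.measurable
      fun_prop
    have hmp := (measurePreserving_piFinSuccAbove (fun _ : Fin (k + 1) => μ) 0).symm
    -- Integrate out the last `k` variables first, with the shift `u + V ω`; this is why `u` is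
    -- generalized in the induction.
    rw [← hmp.lintegral_comp hF, lintegral_prod _ (by exact (hF.comp hmp.measurable).aemeasurable)]
    simp only [MeasurableEquiv.piFinSuccAbove_symm_apply, Fin.insertNthEquiv_zero,
      Fin.consEquiv_apply, Fin.sum_univ_succ, Fin.cons_zero, Fin.cons_succ, ← add_assoc]
    calc _ ≤ ∫⁻ ω, ENNReal.ofReal (√a)⁻¹ *
          ENNReal.ofReal (Real.exp (θ' * ‖u + V ω‖ ^ 2)) ∂μ := by
          refine lintegral_mono fun ω => ?_
          rw [← ENNReal.ofReal_mul (by positivity)]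
          exact ih hk0 (u + V ω)
      _ ≤ ENNReal.ofReal (√a)⁻¹ * ENNReal.ofReal (Real.exp (θ' * D ^ 2) *
            Real.exp ((θ' + 2 * θ' ^ 2 * D ^ 2) * ‖u‖ ^ 2)) := by
          rw [lintegral_const_mul']
          · gcongr
            exact lintegral_exp_norm_add_sq_le hV hD hb h0 u hθ0
          · exact ENNReal.ofReal_ne_top
      _ ≤ _ := by
          rw [← ENNReal.ofReal_mul (by positivity), ← haq, Real.sqrt_mul ha.le, mul_inv,
            mul_assoc (√a)⁻¹]
          refine ENNReal.ofReal_le_ofReal ?_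
          have e1 : Real.exp (θ' * D ^ 2) ≤ (√(1 - q))⁻¹ := by
            rw [le_inv_comm₀ (Real.exp_pos _) (Real.sqrt_pos.2 hq1), ← Real.exp_neg]
            refine Real.sqrt_le_iff.2 ⟨(Real.exp_pos _).le, ?_⟩
            rw [← Real.exp_nat_mul]
            have := Real.add_one_le_exp (-q)
            have e : ((2 : ℕ) : ℝ) * -(θ' * D ^ 2) = -q := by
              rw [hq_def]; push_cast; ring
            rw [e]
            linarith
          have e2 : θ' + 2 * θ' ^ 2 * D ^ 2 ≤ θ / (a * (1 - q)) := by
            rw [← div_div, ← hθ', le_div_iff₀ hq1]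
            have : θ' + 2 * θ' ^ 2 * D ^ 2 = θ' * (1 + q) := by rw [hq_def]; ring
            rw [this]
            nlinarith [mul_nonneg hθ0 (sq_nonneg q)]
          gcongr

/-- Markov's inequality for `exp(θ ‖∑ V‖²)`. The choice `θ = 1 / (4 k D²)` makes `2 k θ D² = 1/2`,
so the prefactor is `√2 ≤ 2`. -/
theorem measure_norm_sum_ge_le (hV : StronglyMeasurable V) (hD : 0 < D)
    (hb : ∀ᵐ ω ∂μ, ‖V ω‖ ≤ D) (h0 : ∫ ω, V ω ∂μ = 0) {k : ℕ} (hk : 0 < k) {s : ℝ} (hs : 0 ≤ s) :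
    (Measure.pi fun _ : Fin k => μ) {z | s ≤ ‖∑ i, V (z i)‖} ≤
      ENNReal.ofReal (2 * Real.exp (-(s ^ 2 / (4 * k * D ^ 2)))) := by
  have hk' : (0 : ℝ) < k := by exact_mod_cast hk
  set θ := 1 / (4 * k * D ^ 2) with hθ
  have hθ0 : 0 ≤ θ := by positivity
  have e : 2 * k * θ * D ^ 2 = 1 / 2 := by rw [hθ]; field_simp; norm_num
  have h := lintegral_exp_norm_add_sum_sq_le hV hD.le hb h0 hθ0 k (by rw [e]; norm_num) 0
  rw [e] at h
  simp only [zero_add, norm_zero, ne_eq, OfNat.ofNat_ne_zero, not_false_eq_true, zero_pow,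
    mul_zero, Real.exp_zero, mul_one] at h
  have hc : (√(1 - 1 / 2 : ℝ))⁻¹ ≤ 2 := by
    rw [inv_le_comm₀ (Real.sqrt_pos.2 (by norm_num)) two_pos]
    exact Real.le_sqrt_of_sq_le (by norm_num)
  have hmarkov := mul_meas_ge_le_lintegral₀ (μ := Measure.pi fun _ : Fin k => μ)
    (f := fun z => ENNReal.ofReal (Real.exp (θ * ‖∑ i, V (z i)‖ ^ 2)))
    (by
      have : StronglyMeasurable fun z : Fin k → Ω => ∑ i, V (z i) :=
        Finset.stronglyMeasurable_fun_sum _ fun i _ => hV.comp_measurable (measurable_pi_apply i)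
      exact ((measurable_const.mul (this.norm.measurable.pow_const 2)).exp.ennreal_ofReal
        ).aemeasurable) (ENNReal.ofReal (Real.exp (θ * s ^ 2)))
  have hsub : {z : Fin k → Ω | s ≤ ‖∑ i, V (z i)‖} ⊆ {z | ENNReal.ofReal (Real.exp (θ * s ^ 2)) ≤
      ENNReal.ofReal (Real.exp (θ * ‖∑ i, V (z i)‖ ^ 2))} := by
    intro z hz
    have hz' : s ≤ ‖∑ i, V (z i)‖ := hz
    refine ENNReal.ofReal_le_ofReal (Real.exp_le_exp.2 ?_)
    gcongr
  have hfin := (mul_le_mul_right (measure_mono hsub) _).trans (hmarkov.trans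
    (h.trans (ENNReal.ofReal_le_ofReal hc)))
  rw [mul_comm, ← ENNReal.le_div_iff_mul_le (.inl (by simp [Real.exp_pos])) (.inl (by simp)),
    ← ENNReal.ofReal_div_of_pos (Real.exp_pos _), div_eq_mul_inv, ← Real.exp_neg] at hfin
  refine hfin.trans (le_of_eq ?_)
  congr 4
  rw [hθ]
  ring

end Concentration

/-! ### The Markov property of the trajectory and the distributional Bellman equation -/

section Trajectory

open Finset Preorder

variable {X : Type*}

/-- The trajectories which agree with `s` up to time `n`. -/
def pathCylinder (s : ℕ → X) (n : ℕ) : Set (ℕ → X) := {ω | ∀ i ≤ n, ω i = s i}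

theorem pathCylinder_eq_preimage (s : ℕ → X) (n : ℕ) :
    pathCylinder s n = frestrictLe (π := fun _ => X) n ⁻¹' {frestrictLe (π := fun _ => X) n s} := by
  ext ω
  simp only [pathCylinder, Set.mem_ofPred_eq, Set.mem_preimage, Set.mem_singleton_iff, funext_iff]
  exact ⟨fun h i => h i (mem_Iic.1 i.2), fun h i hi => h ⟨i, mem_Iic.2 hi⟩⟩

/-- The trajectory with `x` prepended. -/
def consPath (x : X) (ω : ℕ → X) : ℕ → X
  | 0 => x
  | n + 1 => ω n

variable [MeasurableSpace X]

theorem measurable_consPath (x : X) : Measurable (consPath x) :=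
  measurable_pi_lambda _ fun n => by
    cases n
    · exact measurable_const
    · exact measurable_pi_apply _

/-- The history-dependent kernels which only look at the last state. -/
def lastStateKernel (Q : Kernel X X) (n : ℕ) : Kernel ((i : Iic n) → X) X :=
  Q.comap (fun h => h ⟨n, mem_Iic.2 le_rfl⟩) (measurable_pi_apply _)

instance (Q : Kernel X X) [IsMarkovKernel Q] (n : ℕ) : IsMarkovKernel (lastStateKernel Q n) := by
  unfold lastStateKernel; infer_instance

theorem trajectoryLaw_eq_traj (Q : Kernel X X) [IsMarkovKernel Q] (x : X) :
    trajectoryLaw Q x = Kernel.traj (X := fun _ => X) (lastStateKernel Q) 0 (fun _ => x) := rfl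

instance (Q : Kernel X X) [IsMarkovKernel Q] (x : X) :
    IsProbabilityMeasure (trajectoryLaw Q x) := by
  rw [trajectoryLaw_eq_traj]; infer_instance

variable [MeasurableSingletonClass X]

theorem measurableSet_pathCylinder (s : ℕ → X) (n : ℕ) : MeasurableSet (pathCylinder s n) := by
  have : pathCylinder s n = ⋂ i ∈ Set.Iic n, (fun ω : ℕ → X => ω i) ⁻¹' {s i} := by
    ext ω
    simp [pathCylinder]
  rw [this]
  exact MeasurableSet.biInter (Set.to_countable _) fun i _ =>
    measurable_pi_apply i (measurableSet_singleton _)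

theorem trajectoryLaw_pathCylinder_zero (Q : Kernel X X) [IsMarkovKernel Q] (x : X) (s : ℕ → X) :
    trajectoryLaw Q x (pathCylinder s 0) = Set.indicator {s 0} 1 x := by
  have h := Kernel.traj_map_frestrictLe_apply (X := fun _ => X) (κ := lastStateKernel Q) 0 0
    (fun _ => x)
  rw [Kernel.partialTraj_self, Kernel.id_apply, ← trajectoryLaw_eq_traj] at h
  rw [pathCylinder_eq_preimage, ← Measure.map_apply (by fun_prop) (measurableSet_singleton _), h,
    Measure.dirac_apply' _ (measurableSet_singleton _)]
  by_cases hx : x = s 0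
  · have : (fun _ : Iic 0 => x) = frestrictLe (π := fun _ => X) 0 s := by
      funext i
      have : (i : ℕ) = 0 := Nat.le_zero.1 (mem_Iic.1 i.2)
      simp [frestrictLe_apply, this, hx]
    rw [this, hx]
    simp
  · have : (fun _ : Iic 0 => x) ≠ frestrictLe (π := fun _ => X) 0 s := fun h =>
      hx (congrFun h ⟨0, mem_Iic.2 le_rfl⟩)
    simp [hx, this]

theorem trajectoryLaw_pathCylinder_succ (Q : Kernel X X) [IsMarkovKernel Q] (x : X) (s : ℕ → X)
    (n : ℕ) : trajectoryLaw Q x (pathCylinder s (n + 1)) =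
      trajectoryLaw Q x (pathCylinder s n) * Q (s n) {s (n + 1)} := by
  have h := Kernel.partialTraj_compProd_eq_map_traj (X := fun _ => X) (κ := lastStateKernel Q)
    (Nat.zero_le n) (x₀ := fun _ => x)
  rw [← Kernel.traj_map_frestrictLe_apply, ← trajectoryLaw_eq_traj] at h
  have hset : pathCylinder s (n + 1) =
      (fun ω : ℕ → X => (frestrictLe (π := fun _ => X) n ω, ω (n + 1))) ⁻¹'
        ({frestrictLe (π := fun _ => X) n s} ×ˢ {s (n + 1)}) := by
    rw [Set.mk_preimage_prod, ← pathCylinder_eq_preimage]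
    ext ω
    simp only [pathCylinder, Set.mem_ofPred_eq, Set.mem_inter_iff, Set.mem_preimage,
      Set.mem_singleton_iff]
    refine ⟨fun h => ⟨fun i hi => h i (by omega), h _ le_rfl⟩, fun h i hi => ?_⟩
    rcases Nat.le_succ_iff.1 hi with hi | rfl
    exacts [h.1 i hi, h.2]
  have hm : MeasurableSet ({frestrictLe (π := fun _ => X) n s} ×ˢ {s (n + 1)}) :=
    (measurableSet_singleton _).prod (measurableSet_singleton (s (n + 1)))
  rw [hset, ← Measure.map_apply (by fun_prop) hm, ← h,
    Measure.compProd_apply_prod (measurableSet_singleton _) (measurableSet_singleton _),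
    lintegral_singleton, Measure.map_apply (by fun_prop) (measurableSet_singleton _),
    ← pathCylinder_eq_preimage, mul_comm]
  rfl

theorem trajectoryLaw_pathCylinder (Q : Kernel X X) [IsMarkovKernel Q] (x : X) (s : ℕ → X)
    (n : ℕ) : trajectoryLaw Q x (pathCylinder s n) =
      Set.indicator {s 0} 1 x * ∏ i ∈ range n, Q (s i) {s (i + 1)} := by
  induction n with
  | zero => simp [trajectoryLaw_pathCylinder_zero]
  | succ n ih => rw [trajectoryLaw_pathCylinder_succ, ih, prod_range_succ, mul_assoc]

/-- Over a countable state space the cylinders are the atoms of the initial-segment marginals. Every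
finite set of times lies in an initial segment, and a projective limit of finite measures is unique.
-/
theorem ext_of_pathCylinder [Countable X] {μ ν : Measure (ℕ → X)} [IsFiniteMeasure μ]
    (h : ∀ s n, μ (pathCylinder s n) = ν (pathCylinder s n)) : μ = ν := by
  rcases isEmpty_or_nonempty X with hX | ⟨⟨x₀⟩⟩
  · have : IsEmpty (ℕ → X) := inferInstance
    exact (Measure.eq_zero_of_isEmpty μ).trans (Measure.eq_zero_of_isEmpty ν).symm
  have hP : ∀ n, μ.map (frestrictLe (π := fun _ => X) n) = ν.map (frestrictLe n) := by
    intro n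
    refine Measure.ext_of_singleton fun z => ?_
    obtain ⟨s, rfl⟩ : ∃ s : ℕ → X, frestrictLe (π := fun _ => X) n s = z :=
      ⟨fun i => if hi : i ∈ Iic n then z ⟨i, hi⟩ else x₀, by
        ext i
        simp only [frestrictLe_apply, dif_pos i.2]⟩
    rw [Measure.map_apply (by fun_prop) (measurableSet_singleton _),
      Measure.map_apply (by fun_prop) (measurableSet_singleton _), ← pathCylinder_eq_preimage, h]
  have hI : ∀ I : Finset ℕ, μ.map I.restrict = ν.map I.restrict := by
    intro I
    have hs := I.subset_Iic_sup_id
    rw [← restrict₂_comp_restrict hs, ← Measure.map_map (by fun_prop) (by fun_prop),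
      ← Measure.map_map (by fun_prop) (by fun_prop)]
    exact congrArg _ (hP _)
  have h1 : IsProjectiveLimit μ fun I : Finset ℕ => ν.map I.restrict := hI
  have h2 : IsProjectiveLimit ν fun I : Finset ℕ => ν.map I.restrict := fun _ => rfl
  have : ∀ I : Finset ℕ, IsFiniteMeasure (ν.map I.restrict) := fun I => by
    rw [← hI I]; infer_instance
  exact h1.unique h2

-- First-step decomposition, i.e. the Markov property: on cylinders both sides reduce to the same
-- product of transition probabilities.
open scoped Classical in
theorem trajectoryLaw_eq_sum [Fintype X] (Q : Kernel X X) [IsMarkovKernel Q] (x : X) :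
    trajectoryLaw Q x = ∑ y, Q x {y} • (trajectoryLaw Q y).map (consPath x) := by
  refine ext_of_pathCylinder fun s n => ?_
  simp only [Measure.finsetSum_apply, Measure.smul_apply, smul_eq_mul]
  simp only [Measure.map_apply (measurable_consPath x) (measurableSet_pathCylinder s n)]
  cases n with
  | zero =>
    have : consPath x ⁻¹' pathCylinder s 0 = if x = s 0 then Set.univ else ∅ := by
      ext ω
      by_cases hx : x = s 0 <;> simp [pathCylinder, consPath, hx]
    rw [this, trajectoryLaw_pathCylinder_zero]
    by_cases hx : x = s 0
    · simp only [hx, if_true, measure_univ, mul_one]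
      have : ∑ y, Q (s 0) {y} = Q (s 0) Set.univ := by
        rw [← Finset.coe_univ, ← sum_measure_singleton]
      rw [this]
      simp
    · simp [hx]
  | succ n =>
    have : consPath x ⁻¹' pathCylinder s (n + 1) =
        if x = s 0 then pathCylinder (fun i => s (i + 1)) n else ∅ := by
      ext ω
      have : (∀ i ≤ n + 1, consPath x ω i = s i) ↔ x = s 0 ∧ ∀ i ≤ n, ω i = s (i + 1) := by
        refine ⟨fun h => ⟨h 0 (by omega), fun i hi => h (i + 1) (by omega)⟩, fun h i hi => ?_⟩
        cases i with
        | zero => exact h.1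
        | succ i => exact h.2 i (by omega)
      rw [Set.mem_preimage, pathCylinder, Set.mem_ofPred_eq, this]
      by_cases hx : x = s 0 <;> simp [pathCylinder, hx]
    rw [this, trajectoryLaw_pathCylinder]
    by_cases hx : x = s 0
    · simp only [hx, if_true, trajectoryLaw_pathCylinder]
      rw [Finset.sum_eq_single (s 1)]
      · rw [prod_range_succ']
        simp [mul_comm]
      · intro y _ hy
        simp [hy]
      · simp
    · simp [hx]

end Trajectory

/-! ### Discounted returns, their range, and the Bellman fixed point. -/

section Return

variable {X : Type*} {d : ℕ} {r : X → EuclideanSpace ℝ (Fin d)} {R γ : ℝ}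

theorem isClosed_returnSpace (d : ℕ) (R γ : ℝ) : IsClosed (returnSpace d R γ) := by
  simp only [returnSpace, Set.ofPred_forall, Set.ofPred_and]
  exact isClosed_iInter fun i => (isClosed_le continuous_const (by fun_prop)).inter
    (isClosed_le (by fun_prop) continuous_const)

/-- The side length of the cube solves `R / (1 - γ) = R + γ * (R / (1 - γ))`. -/
theorem bellman_mem_returnSpace (hγ0 : 0 < γ) (hγ1 : γ < 1)
    (hr : ∀ x i, 0 ≤ r x i ∧ r x i ≤ R) (x : X) {z : EuclideanSpace ℝ (Fin d)}
    (hz : z ∈ returnSpace d R γ) : r x + γ • z ∈ returnSpace d R γ := by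
  intro i
  have h1 := hr x i
  have h2 := hz i
  simp only [PiLp.add_apply, PiLp.smul_apply, smul_eq_mul]
  refine ⟨by nlinarith, ?_⟩
  have : R / (1 - γ) = R + γ * (R / (1 - γ)) := by
    have : 1 - γ ≠ 0 := by linarith
    field_simp
    ring
  nlinarith

theorem norm_le_of_coord_le {z : EuclideanSpace ℝ (Fin d)} {c : ℝ} (hc : 0 ≤ c)
    (h : ∀ i, |z i| ≤ c) : ‖z‖ ≤ √d * c := by
  rw [EuclideanSpace.norm_eq, ← Real.sqrt_sq hc, ← Real.sqrt_mul (Nat.cast_nonneg d)]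
  refine Real.sqrt_le_sqrt ?_
  calc ∑ i, ‖z i‖ ^ 2 ≤ ∑ _i : Fin d, c ^ 2 := by
        refine Finset.sum_le_sum fun i _ => ?_
        rw [Real.norm_eq_abs]
        gcongr
        exact h i
    _ = d * c ^ 2 := by simp

theorem norm_sub_le_of_mem_returnSpace (hR : 0 ≤ R) (hγ1 : γ < 1)
    {x y : EuclideanSpace ℝ (Fin d)} (hx : x ∈ returnSpace d R γ) (hy : y ∈ returnSpace d R γ) :
    ‖x - y‖ ≤ √d * (R / (1 - γ)) := by
  refine norm_le_of_coord_le (div_nonneg hR (by linarith)) fun i => ?_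
  rw [PiLp.sub_apply, abs_le]
  have h1 := hx i
  have h2 := hy i
  constructor <;> linarith

theorem summable_discountedReturn (hR : 0 ≤ R) (hγ0 : 0 < γ) (hγ1 : γ < 1)
    (hr : ∀ x i, 0 ≤ r x i ∧ r x i ≤ R) (ω : ℕ → X) :
    Summable fun t : ℕ => γ ^ t • r (ω t) := by
  refine Summable.of_norm_bounded (g := fun t : ℕ => γ ^ t * (√d * R))
    ((summable_geometric_of_lt_one hγ0.le hγ1).mul_right _) fun t => ?_
  rw [norm_smul, norm_pow, Real.norm_of_nonneg hγ0.le]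
  gcongr
  refine norm_le_of_coord_le hR fun i => ?_
  rw [abs_of_nonneg (hr _ i).1]
  exact (hr _ i).2

theorem discountedReturn_consPath (hR : 0 ≤ R) (hγ0 : 0 < γ) (hγ1 : γ < 1)
    (hr : ∀ x i, 0 ≤ r x i ∧ r x i ≤ R) (x : X) (ω : ℕ → X) :
    discountedReturn r γ (consPath x ω) = r x + γ • discountedReturn r γ ω := by
  rw [discountedReturn, (summable_discountedReturn hR hγ0 hγ1 hr _).tsum_eq_zero_add,
    discountedReturn, ← tsum_const_smul'' γ]
  simp [consPath, pow_succ', mul_smul]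

theorem discountedReturn_mem_returnSpace (hR : 0 ≤ R) (hγ0 : 0 < γ) (hγ1 : γ < 1)
    (hr : ∀ x i, 0 ≤ r x i ∧ r x i ≤ R) (ω : ℕ → X) :
    discountedReturn r γ ω ∈ returnSpace d R γ := by
  have hs := (summable_discountedReturn hR hγ0 hγ1 hr ω).hasSum
  intro i
  have hi : HasSum (fun t : ℕ => γ ^ t * r (ω t) i) (discountedReturn r γ ω i) := by
    simpa [discountedReturn] using hs.mapL (EuclideanSpace.proj (𝕜 := ℝ) i)
  refine ⟨hi.nonneg fun t => mul_nonneg (by positivity) (hr _ i).1, ?_⟩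
  refine hasSum_le (fun t => ?_) hi (((hasSum_geometric_of_lt_one hγ0.le hγ1).mul_left R))
  rw [mul_comm]
  have := (hr (ω t) i).2
  gcongr

theorem measurable_discountedReturn [MeasurableSpace X] (hrm : Measurable r) (hR : 0 ≤ R)
    (hγ0 : 0 < γ) (hγ1 : γ < 1) (hr : ∀ x i, 0 ≤ r x i ∧ r x i ≤ R) :
    Measurable (discountedReturn r γ) := by
  refine measurable_of_tendsto_metrizable
    (f := fun n (ω : ℕ → X) => ∑ t ∈ Finset.range n, γ ^ t • r (ω t)) (fun n => ?_) ?_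
  · exact Finset.measurable_fun_sum _ fun t _ =>
      (hrm.comp (measurable_pi_apply t)).const_smul (γ ^ t)
  · rw [tendsto_pi_nhds]
    exact fun ω => (summable_discountedReturn hR hγ0 hγ1 hr ω).hasSum.tendsto_sum_nat

/-- The distributional Bellman equation. -/
theorem returnDistribution_eq_sum [Fintype X] [MeasurableSpace X] [MeasurableSingletonClass X]
    (Q : Kernel X X) [IsMarkovKernel Q] (hR : 0 ≤ R) (hγ0 : 0 < γ) (hγ1 : γ < 1)
    (hr : ∀ x i, 0 ≤ r x i ∧ r x i ≤ R) (x : X) :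
    returnDistribution Q r γ x =
      ∑ y, Q x {y} • (returnDistribution Q r γ y).map (fun z => r x + γ • z) := by
  have hm := measurable_discountedReturn (measurable_of_finite r) hR hγ0 hγ1 hr
  have hc : (discountedReturn r γ) ∘ consPath x =
      (fun z => r x + γ • z) ∘ discountedReturn r γ :=
    funext fun ω => discountedReturn_consPath hR hγ0 hγ1 hr x ω
  have hmap : Measurable fun z : EuclideanSpace ℝ (Fin d) => r x + γ • z := by fun_prop
  conv_lhs => rw [returnDistribution, trajectoryLaw_eq_sum]
  rw [← Measure.mapₗ_apply_of_measurable hm, map_sum]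
  refine Finset.sum_congr rfl fun y _ => ?_
  rw [Measure.mapₗ_apply_of_measurable hm, Measure.map_smul, returnDistribution,
    Measure.map_map hm (measurable_consPath x), Measure.map_map hmap hm, hc]

theorem ae_returnDistribution_mem_returnSpace [MeasurableSpace X] (Q : Kernel X X)
    [IsMarkovKernel Q] (hrm : Measurable r) (hR : 0 ≤ R) (hγ0 : 0 < γ) (hγ1 : γ < 1)
    (hr : ∀ x i, 0 ≤ r x i ∧ r x i ≤ R) (x : X) :
    ∀ᵐ z ∂(returnDistribution Q r γ x), z ∈ returnSpace d R γ := by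
  refine (ae_map_iff (measurable_discountedReturn hrm hR hγ0 hγ1 hr).aemeasurable
    (isClosed_returnSpace d R γ).measurableSet).2 ?_
  exact .of_forall fun ω => discountedReturn_mem_returnSpace hR hγ0 hγ1 hr ω

theorem isProbabilityMeasure_returnDistribution [MeasurableSpace X] (Q : Kernel X X)
    [IsMarkovKernel Q] (hrm : Measurable r) (hR : 0 ≤ R) (hγ0 : 0 < γ) (hγ1 : γ < 1)
    (hr : ∀ x i, 0 ≤ r x i ∧ r x i ≤ R) (x : X) :
    IsProbabilityMeasure (returnDistribution Q r γ x) :=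
  Measure.isProbabilityMeasure_map (measurable_discountedReturn hrm hR hγ0 hγ1 hr).aemeasurable

end Return

/-! ### Maximum mean discrepancies as distances of mean embeddings -/

section Embedding

variable {E H : Type*} [MeasurableSpace E] [NormedAddCommGroup H] [InnerProductSpace ℝ H]
  {κ : E → E → ℝ} {Φ Ψ : E → H} {p q : Measure E}

theorem integrable_inner_prod [SFinite p] [SFinite q] (hp : Integrable Φ p)
    (hq : Integrable Φ q) : Integrable (fun w : E × E => inner ℝ (Φ w.1) (Φ w.2)) (p.prod q) :=
  Integrable.mono' (hp.norm.mul_prod hq.norm)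
    (hp.aestronglyMeasurable.comp_fst.inner hq.aestronglyMeasurable.comp_snd)
    (.of_forall fun _ => norm_inner_le_norm _ _)

variable [CompleteSpace H]

theorem integral_inner_prod [SFinite p] [SFinite q] (hp : Integrable Φ p)
    (hq : Integrable Φ q) : ∫ w : E × E, inner ℝ (Φ w.1) (Φ w.2) ∂(p.prod q) =
      inner ℝ (∫ x, Φ x ∂p) (∫ x, Φ x ∂q) := by
  rw [integral_prod _ (integrable_inner_prod hp hq)]
  simp only [integral_inner hq]
  rw [real_inner_comm, ← integral_inner hp]
  simp only [real_inner_comm]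

theorem mmd_eq_norm_sub [SFinite p] [SFinite q] (hκ : ∀ x y, inner ℝ (Φ x) (Φ y) = κ x y)
    (hp : Integrable Φ p) (hq : Integrable Φ q) :
    mmd κ p q = ‖∫ x, Φ x ∂p - ∫ x, Φ x ∂q‖ := by
  simp only [mmd, ← hκ]
  rw [integral_inner_prod hp hp, integral_inner_prod hp hq, integral_inner_prod hq hq,
    real_inner_self_eq_norm_sq, real_inner_self_eq_norm_sq, ← norm_sub_sq_real,
    Real.sqrt_sq (norm_nonneg _)]

theorem mmd_const_mul {c : ℝ} (hc : 0 ≤ c) :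
    mmd (fun x y => c * κ x y) p q = √c * mmd κ p q := by
  simp only [mmd, integral_const_mul]
  rw [← Real.sqrt_mul hc]
  congr 1
  ring

/-- `Ψ` need not be a linear image of `Φ`, but distances determine inner products after recentring
at a point `e`, so the two recentred Gram kernels are proportional. Recentring does not affect the
difference of the means, since both measures have mass one. -/
theorem norm_integral_sub_of_norm_sub_sq [IsProbabilityMeasure p] [IsProbabilityMeasure q]
    {c : ℝ} (hc : 0 ≤ c) (h : ∀ x y, ‖Ψ x - Ψ y‖ ^ 2 = c * ‖Φ x - Φ y‖ ^ 2)
    (hp : Integrable Φ p) (hq : Integrable Φ q) (hp' : Integrable Ψ p) (hq' : Integrable Ψ q) :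
    ‖∫ x, Ψ x ∂p - ∫ x, Ψ x ∂q‖ = √c * ‖∫ x, Φ x ∂p - ∫ x, Φ x ∂q‖ := by
  have : Nonempty E := p.nonempty_of_neZero
  let e : E := Classical.arbitrary E
  have key : ∀ x y, inner ℝ (Ψ x - Ψ e) (Ψ y - Ψ e) =
      c * inner ℝ (Φ x - Φ e) (Φ y - Φ e) := fun x y => by
    rw [real_inner_eq_norm_mul_self_add_norm_mul_self_sub_norm_sub_mul_self_div_two,
      real_inner_eq_norm_mul_self_add_norm_mul_self_sub_norm_sub_mul_self_div_two]
    simp only [sub_sub_sub_cancel_right, ← sq, h]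
    ring
  have hsub : ∀ (F : E → H), Integrable F p → Integrable F q →
      ∫ x, (F x - F e) ∂p - ∫ x, (F x - F e) ∂q = ∫ x, F x ∂p - ∫ x, F x ∂q := by
    intro F h1 h2
    rw [integral_sub h1 (integrable_const _), integral_sub h2 (integrable_const _)]
    simp
  rw [← hsub Ψ hp' hq', ← hsub Φ hp hq,
    ← mmd_eq_norm_sub key (hp'.sub (integrable_const _)) (hq'.sub (integrable_const _)),
    ← mmd_eq_norm_sub (Φ := fun x => Φ x - Φ e) (fun x y => rfl)
      (hp.sub (integrable_const _)) (hq.sub (integrable_const _)), mmd_const_mul hc]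

theorem norm_integral_sub_const_le [IsProbabilityMeasure p] (hp : Integrable Φ p) {v : H} {D : ℝ}
    (h : ∀ᵐ x ∂p, ‖Φ x - v‖ ≤ D) : ‖∫ x, Φ x ∂p - v‖ ≤ D := by
  have : ∫ x, Φ x ∂p - v = ∫ x, (Φ x - v) ∂p := by
    rw [integral_sub hp (integrable_const _)]
    simp
  rw [this]
  simpa using norm_integral_le_of_norm_le_const h

end Embedding

/-! ### The distributional Bellman operator -/

section Bellman

variable {X : Type*} [Fintype X] [MeasurableSpace X] {d : ℕ}

/-- The distributional Bellman operator. -/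
def bellman (Q : Kernel X X) (r : X → EuclideanSpace ℝ (Fin d)) (γ : ℝ)
    (η : X → Measure (EuclideanSpace ℝ (Fin d))) (x : X) : Measure (EuclideanSpace ℝ (Fin d)) :=
  ∑ y, Q x {y} • (η y).map (fun z => r x + γ • z)

variable [MeasurableSingletonClass X] {Q : Kernel X X} [IsMarkovKernel Q]
  {r : X → EuclideanSpace ℝ (Fin d)} {R γ : ℝ}

theorem sum_kernel_singleton (Q : Kernel X X) [IsMarkovKernel Q] (x : X) :
    ∑ y, Q x {y} = 1 := by
  rw [sum_measure_singleton, Finset.coe_univ, measure_univ]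

theorem sum_kernel_singleton_toReal (Q : Kernel X X) [IsMarkovKernel Q] (x : X) :
    ∑ y, (Q x {y}).toReal = 1 := by
  rw [← ENNReal.toReal_sum fun y _ => measure_ne_top _ _, sum_kernel_singleton,
    ENNReal.toReal_one]

/-- Unbiasedness of the algorithm: given `η`, each new particle is distributed as the Bellman image
of `η`. -/
theorem sampleLaw_map_eq_bellman (η : X → ProbabilityMeasure (EuclideanSpace ℝ (Fin d)))
    (x : X) : (sampleLaw Q x η).map (fun ω => r x + γ • ω.2) =
      bellman Q r γ (fun y => (η y : Measure (EuclideanSpace ℝ (Fin d)))) x := by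
  ext s hs
  have hm : Measurable fun ω : X × EuclideanSpace ℝ (Fin d) => r x + γ • ω.2 := by fun_prop
  have hm' : Measurable fun z : EuclideanSpace ℝ (Fin d) => r x + γ • z := by fun_prop
  rw [Measure.map_apply hm hs, sampleLaw, Measure.compProd_apply (hm hs), lintegral_fintype,
    bellman, Measure.finsetSum_apply]
  refine Finset.sum_congr rfl fun y _ => ?_
  rw [Measure.smul_apply, Measure.map_apply hm' hs, smul_eq_mul, mul_comm]
  rfl

instance (η : X → Measure (EuclideanSpace ℝ (Fin d))) [∀ y, IsProbabilityMeasure (η y)] (x : X) :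
    IsProbabilityMeasure (bellman Q r γ η x) := by
  have hm : Measurable fun z : EuclideanSpace ℝ (Fin d) => r x + γ • z := by fun_prop
  have : ∀ y, IsProbabilityMeasure ((η y).map fun z => r x + γ • z) := fun y =>
    Measure.isProbabilityMeasure_map hm.aemeasurable
  exact ⟨by simp [bellman]⟩

omit [MeasurableSingletonClass X] [IsMarkovKernel Q] in
theorem ae_bellman_mem_returnSpace (hγ0 : 0 < γ) (hγ1 : γ < 1)
    (hr : ∀ x i, 0 ≤ r x i ∧ r x i ≤ R) {η : X → Measure (EuclideanSpace ℝ (Fin d))}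
    (hη : ∀ y, ∀ᵐ z ∂(η y), z ∈ returnSpace d R γ) (x : X) :
    ∀ᵐ z ∂(bellman Q r γ η x), z ∈ returnSpace d R γ := by
  have hm : Measurable fun z : EuclideanSpace ℝ (Fin d) => r x + γ • z := by fun_prop
  have hs := (isClosed_returnSpace d R γ).measurableSet
  have h0 : bellman Q r γ η x (returnSpace d R γ)ᶜ = 0 := by
    rw [bellman, Measure.finsetSum_apply]
    refine Finset.sum_eq_zero fun y _ => ?_
    rw [Measure.smul_apply, Measure.map_apply hm hs.compl, smul_eq_mul]
    refine mul_eq_zero_of_right _ (measure_mono_null (fun z hz => ?_) (hη y))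
    exact fun hz' => hz (bellman_mem_returnSpace hγ0 hγ1 hr x hz')
  exact h0

end Bellman

/-! ### Features on the cube of returns. -/

section ReturnSpace

variable {d : ℕ} {R γ α : ℝ} {H : Type*} [NormedAddCommGroup H]
  {Φ : EuclideanSpace ℝ (Fin d) → H}

/-- The base on the right bounds the diameter of the return cube, so `√(returnScale d R γ α)` bounds
its diameter in feature space. -/
theorem returnScale_eq (hR : 0 ≤ R) (hγ1 : γ < 1) :
    returnScale d R γ α = (√d * (R / (1 - γ))) ^ α := by
  have h1 : 0 < 1 - γ := by linarith
  rw [Real.mul_rpow (Real.sqrt_nonneg _) (by positivity), Real.div_rpow hR h1.le,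
    Real.sqrt_eq_rpow, ← Real.rpow_mul (Nat.cast_nonneg d), returnScale]
  ring_nf

theorem returnScale_nonneg (hR : 0 ≤ R) (hγ1 : γ < 1) : 0 ≤ returnScale d R γ α := by
  have h1 : 0 < 1 - γ := by linarith
  rw [returnScale_eq hR hγ1]
  positivity

theorem norm_feature_sub_le (hα : 0 < α) (hR : 0 ≤ R) (hγ1 : γ < 1)
    (hΦ : ∀ x y, ‖Φ x - Φ y‖ ^ 2 = ‖x - y‖ ^ α) {x y : EuclideanSpace ℝ (Fin d)}
    (hx : x ∈ returnSpace d R γ) (hy : y ∈ returnSpace d R γ) :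
    ‖Φ x - Φ y‖ ≤ √(returnScale d R γ α) := by
  refine Real.le_sqrt_of_sq_le ?_
  rw [hΦ, returnScale_eq hR hγ1]
  exact Real.rpow_le_rpow (norm_nonneg _) (norm_sub_le_of_mem_returnSpace hR hγ1 hx hy) hα.le

theorem norm_feature_affine_sub (hγ0 : 0 < γ)
    (hΦ : ∀ x y, ‖Φ x - Φ y‖ ^ 2 = ‖x - y‖ ^ α) (b x y : EuclideanSpace ℝ (Fin d)) :
    ‖Φ (b + γ • x) - Φ (b + γ • y)‖ ^ 2 = γ ^ α * ‖Φ x - Φ y‖ ^ 2 := by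
  rw [hΦ, hΦ, add_sub_add_left_eq_sub, ← smul_sub, norm_smul, Real.norm_of_nonneg hγ0.le,
    Real.mul_rpow hγ0.le (norm_nonneg _)]

theorem integrable_feature (hα : 0 < α) (hR : 0 ≤ R) (hγ1 : γ < 1)
    (hc : Continuous Φ) (hΦ : ∀ x y, ‖Φ x - Φ y‖ ^ 2 = ‖x - y‖ ^ α)
    {p : Measure (EuclideanSpace ℝ (Fin d))} [IsFiniteMeasure p]
    (hp : ∀ᵐ z ∂p, z ∈ returnSpace d R γ) : Integrable Φ p := by
  have h0 : (0 : EuclideanSpace ℝ (Fin d)) ∈ returnSpace d R γ := fun i =>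
    ⟨le_rfl, div_nonneg hR (by linarith)⟩
  refine Integrable.of_bound hc.aestronglyMeasurable (‖Φ 0‖ + √(returnScale d R γ α)) ?_
  filter_upwards [hp] with z hz
  have := norm_feature_sub_le hα hR hγ1 hΦ hz h0
  calc ‖Φ z‖ = ‖Φ 0 + (Φ z - Φ 0)‖ := by simp
    _ ≤ _ := (norm_add_le _ _).trans (by gcongr)

variable [InnerProductSpace ℝ H] [CompleteSpace H]

theorem norm_integral_feature_sub_le (hα : 0 < α) (hR : 0 ≤ R) (hγ1 : γ < 1)
    (hc : Continuous Φ) (hΦ : ∀ x y, ‖Φ x - Φ y‖ ^ 2 = ‖x - y‖ ^ α)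
    {p q : Measure (EuclideanSpace ℝ (Fin d))} [IsProbabilityMeasure p] [IsProbabilityMeasure q]
    (hp : ∀ᵐ z ∂p, z ∈ returnSpace d R γ) (hq : ∀ᵐ z ∂q, z ∈ returnSpace d R γ) :
    ‖∫ z, Φ z ∂p - ∫ z, Φ z ∂q‖ ≤ √(returnScale d R γ α) := by
  refine norm_integral_sub_const_le (integrable_feature hα hR hγ1 hc hΦ hp) ?_
  filter_upwards [hp] with x hx
  rw [norm_sub_rev]
  refine norm_integral_sub_const_le (integrable_feature hα hR hγ1 hc hΦ hq) ?_
  filter_upwards [hq] with y hy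
  exact norm_feature_sub_le hα hR hγ1 hΦ hy hx

end ReturnSpace

/-! ### Contraction of the Bellman operator in mean embedding distance. -/

section Contraction

variable {X : Type*} [Fintype X] [MeasurableSpace X] [MeasurableSingletonClass X] {d : ℕ}
  {Q : Kernel X X} [IsMarkovKernel Q] {r : X → EuclideanSpace ℝ (Fin d)} {R γ α : ℝ}
  {H : Type*} [NormedAddCommGroup H] [InnerProductSpace ℝ H] [CompleteSpace H]
  {Φ : EuclideanSpace ℝ (Fin d) → H}

omit [MeasurableSingletonClass X] [CompleteSpace H] in
theorem integral_bellman (hα : 0 < α) (hR : 0 ≤ R) (hγ0 : 0 < γ) (hγ1 : γ < 1)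
    (hr : ∀ x i, 0 ≤ r x i ∧ r x i ≤ R)
    (hc : Continuous Φ) (hΦ : ∀ x y, ‖Φ x - Φ y‖ ^ 2 = ‖x - y‖ ^ α)
    {η : X → Measure (EuclideanSpace ℝ (Fin d))} [∀ y, IsProbabilityMeasure (η y)]
    (hη : ∀ y, ∀ᵐ z ∂(η y), z ∈ returnSpace d R γ) (x : X) :
    (∀ y, Integrable (fun z => Φ (r x + γ • z)) (η y)) ∧
    ∫ z, Φ z ∂(bellman Q r γ η x) =
      ∑ y, (Q x {y}).toReal • ∫ z, Φ (r x + γ • z) ∂(η y) := by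
  have hm : Measurable fun z : EuclideanSpace ℝ (Fin d) => r x + γ • z := by fun_prop
  have hi : ∀ y, Integrable Φ ((η y).map fun z => r x + γ • z) := fun y => by
    have := Measure.isProbabilityMeasure_map (μ := η y) hm.aemeasurable
    refine integrable_feature hα hR hγ1 hc hΦ ((ae_map_iff hm.aemeasurable
      (isClosed_returnSpace d R γ).measurableSet).2 ?_)
    filter_upwards [hη y] with z hz using bellman_mem_returnSpace hγ0 hγ1 hr x hz
  refine ⟨fun y => (integrable_map_measure hc.aestronglyMeasurable hm.aemeasurable).1 (hi y), ?_⟩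
  rw [bellman, integral_finsetSum_measure fun y _ => (hi y).smul_measure (measure_ne_top _ _)]
  refine Finset.sum_congr rfl fun y _ => ?_
  rw [integral_smul_measure, integral_map hm.aemeasurable hc.aestronglyMeasurable]

/-- The Bellman image is a convex combination of affine push-forwards, and each push-forward scales
embedding distances by `√(γ ^ α)`. -/
theorem norm_integral_bellman_sub_le (hα : 0 < α) (hR : 0 ≤ R) (hγ0 : 0 < γ) (hγ1 : γ < 1)
    (hr : ∀ x i, 0 ≤ r x i ∧ r x i ≤ R)
    (hc : Continuous Φ) (hΦ : ∀ x y, ‖Φ x - Φ y‖ ^ 2 = ‖x - y‖ ^ α)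
    {η ζ : X → Measure (EuclideanSpace ℝ (Fin d))} [∀ y, IsProbabilityMeasure (η y)]
    [∀ y, IsProbabilityMeasure (ζ y)] (hη : ∀ y, ∀ᵐ z ∂(η y), z ∈ returnSpace d R γ)
    (hζ : ∀ y, ∀ᵐ z ∂(ζ y), z ∈ returnSpace d R γ) {a : ℝ}
    (ha : ∀ y, ‖∫ z, Φ z ∂(η y) - ∫ z, Φ z ∂(ζ y)‖ ≤ a) (x : X) :
    ‖∫ z, Φ z ∂(bellman Q r γ η x) - ∫ z, Φ z ∂(bellman Q r γ ζ x)‖ ≤ γ ^ (α / 2) * a := by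
  obtain ⟨hi, he⟩ := integral_bellman (Q := Q) hα hR hγ0 hγ1 hr hc hΦ hη x
  obtain ⟨hi', he'⟩ := integral_bellman (Q := Q) hα hR hγ0 hγ1 hr hc hΦ hζ x
  have hsq : √(γ ^ α) = γ ^ (α / 2) := by
    rw [Real.sqrt_eq_rpow, ← Real.rpow_mul hγ0.le]
    ring_nf
  rw [he, he', ← Finset.sum_sub_distrib]
  calc _ ≤ ∑ y, (Q x {y}).toReal * (γ ^ (α / 2) * a) := by
        refine norm_sum_le_of_le _ fun y _ => ?_
        rw [← smul_sub, norm_smul, Real.norm_of_nonneg ENNReal.toReal_nonneg,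
          norm_integral_sub_of_norm_sub_sq (Real.rpow_nonneg hγ0.le α)
            (norm_feature_affine_sub hγ0 hΦ (r x))
            (integrable_feature hα hR hγ1 hc hΦ (hη y))
            (integrable_feature hα hR hγ1 hc hΦ (hζ y)) (hi y) (hi' y), hsq]
        gcongr
        exact ha y
    _ = γ ^ (α / 2) * a := by
        rw [← Finset.sum_mul, sum_kernel_singleton_toReal, one_mul]

end Contraction

/-! ### Measurability of the maximum mean discrepancy -/

section Measurability

variable {X E : Type*} [MeasurableSpace E] {κ : E → E → ℝ}

/-- The kernel sending a family of distributions to its member at `x`. -/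
def evalKernel (E : Type*) [MeasurableSpace E] (x : X) : Kernel (X → ProbabilityMeasure E) E :=
  ⟨fun η => (η x : Measure E), measurable_subtype_coe.comp (measurable_pi_apply x)⟩

instance (x : X) : IsMarkovKernel (evalKernel E x) := ⟨fun η => (η x).2⟩

theorem measurable_mmd (hκ : Measurable (Function.uncurry κ)) (x : X) (q : Measure E)
    [IsProbabilityMeasure q] :
    Measurable fun η : X → ProbabilityMeasure E => mmd κ (η x : Measure E) q := by
  have h1 : Measurable fun η : X → ProbabilityMeasure E =>
      ∫ w, κ w.1 w.2 ∂((η x : Measure E).prod (η x)) := by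
    have := (hκ.stronglyMeasurable.integral_kernel
      (κ := evalKernel E x ×ₖ evalKernel E x)).measurable
    simp only [Kernel.prod_apply] at this
    exact this
  have h2 : Measurable fun η : X → ProbabilityMeasure E =>
      ∫ w, κ w.1 w.2 ∂((η x : Measure E).prod q) := by
    have := (hκ.stronglyMeasurable.integral_kernel
      (κ := evalKernel E x ×ₖ Kernel.const _ q)).measurable
    simp only [Kernel.prod_apply, Kernel.const_apply] at this
    exact this
  exact ((h1.sub (h2.const_mul 2)).add_const _).sqrt

end Measurability

theorem measurable_inducedKernel_energySemimetric {d : ℕ} {α : ℝ}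
    (y₀ : EuclideanSpace ℝ (Fin d)) :
    Measurable (Function.uncurry (inducedKernel (energySemimetric α) y₀)) := by
  unfold Function.uncurry inducedKernel energySemimetric
  fun_prop

/-! ### One step of randomized dynamic programming -/

section Step

variable {X : Type*} {d : ℕ}

/-- The families of return distributions on the return space which are `a`-close to `ν`. -/
def closeRDF (R γ : ℝ) (κ : EuclideanSpace ℝ (Fin d) → EuclideanSpace ℝ (Fin d) → ℝ)
    (ν : X → Measure (EuclideanSpace ℝ (Fin d))) (a : ℝ) :
    Set (X → ProbabilityMeasure (EuclideanSpace ℝ (Fin d))) :=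
  {η | ∀ x, (∀ᵐ z ∂(η x : Measure (EuclideanSpace ℝ (Fin d))), z ∈ returnSpace d R γ) ∧
    mmd κ (η x) (ν x) ≤ a}

theorem measurableSet_closeRDF [Countable X] {R γ : ℝ}
    {κ : EuclideanSpace ℝ (Fin d) → EuclideanSpace ℝ (Fin d) → ℝ}
    (hκ : Measurable (Function.uncurry κ)) (ν : X → Measure (EuclideanSpace ℝ (Fin d)))
    [∀ x, IsProbabilityMeasure (ν x)] (a : ℝ) : MeasurableSet (closeRDF R γ κ ν a) := by
  have : closeRDF R γ κ ν a = ⋂ x, {η | evalKernel _ x η (returnSpace d R γ)ᶜ = 0} ∩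
      {η | mmd κ (η x) (ν x) ≤ a} := by
    ext η
    simp only [closeRDF, Set.mem_ofPred_eq, Set.mem_iInter, Set.mem_inter_iff]
    rfl
  rw [this]
  exact MeasurableSet.iInter fun x =>
    ((Kernel.measurable_coe _ (isClosed_returnSpace d R γ).measurableSet.compl)
      (measurableSet_singleton 0)).inter (measurableSet_le (measurable_mmd hκ x _) measurable_const)

theorem integral_ewp {H : Type*} [NormedAddCommGroup H] [NormedSpace ℝ H] [CompleteSpace H]
    {m : ℕ} [NeZero m] (θ : Fin m → EuclideanSpace ℝ (Fin d))
    {Φ : EuclideanSpace ℝ (Fin d) → H} (hc : Continuous Φ) :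
    ∫ z, Φ z ∂(ewp m θ : Measure (EuclideanSpace ℝ (Fin d))) = (m : ℝ)⁻¹ • ∑ i, Φ (θ i) := by
  change ∫ z, Φ z ∂((m : ℝ≥0∞)⁻¹ • ∑ i, Measure.dirac (θ i)) = _
  rw [integral_smul_measure, integral_finsetSum_measure fun i _ =>
    integrable_dirac' hc.stronglyMeasurable (by simp)]
  simp

theorem ae_ewp_of_forall {m : ℕ} [NeZero m] {θ : Fin m → EuclideanSpace ℝ (Fin d)}
    {s : Set (EuclideanSpace ℝ (Fin d))} (hs : MeasurableSet s) (h : ∀ i, θ i ∈ s) :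
    ∀ᵐ z ∂(ewp m θ : Measure (EuclideanSpace ℝ (Fin d))), z ∈ s := by
  have h0 : ((m : ℝ≥0∞)⁻¹ • ∑ i, Measure.dirac (θ i)) sᶜ = 0 := by
    simp [Measure.finsetSum_apply, Measure.dirac_apply' _ hs.compl, h]
  exact h0

variable [Fintype X] [MeasurableSpace X] [MeasurableSingletonClass X]
  {Q : Kernel X X} [IsMarkovKernel Q] {r : X → EuclideanSpace ℝ (Fin d)} {R γ α : ℝ}
  {H : Type*} [NormedAddCommGroup H] [InnerProductSpace ℝ H] [CompleteSpace H]
  {Φ : EuclideanSpace ℝ (Fin d) → H}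
  {κ : EuclideanSpace ℝ (Fin d) → EuclideanSpace ℝ (Fin d) → ℝ}

theorem ae_sampleLaw_mem_returnSpace
    {η : X → ProbabilityMeasure (EuclideanSpace ℝ (Fin d))}
    (hη : ∀ y, ∀ᵐ z ∂(η y : Measure (EuclideanSpace ℝ (Fin d))), z ∈ returnSpace d R γ) (x : X) :
    ∀ᵐ ω ∂(sampleLaw Q x η), ω.2 ∈ returnSpace d R γ := by
  have hs := (isClosed_returnSpace d R γ).measurableSet.compl
  have h0 : sampleLaw Q x η (Prod.snd ⁻¹' (returnSpace d R γ)ᶜ) = 0 := by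
    rw [sampleLaw, Measure.compProd_apply (measurable_snd hs), lintegral_fintype]
    exact Finset.sum_eq_zero fun y _ => mul_eq_zero_of_left (hη y) _
  exact h0

/-- `B` is only an upper bound for the return scale, so that it can be positive even if all returns
coincide. -/
theorem measure_particle_deviation_le (hα : 0 < α) (hR : 0 ≤ R) (hγ0 : 0 < γ) (hγ1 : γ < 1)
    (hr : ∀ x i, 0 ≤ r x i ∧ r x i ≤ R) (hc : Continuous Φ)
    (hΦ : ∀ x y, ‖Φ x - Φ y‖ ^ 2 = ‖x - y‖ ^ α) {B : ℝ} (hB0 : 0 < B) (hB : returnScale d R γ α ≤ B)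
    {m : ℕ} [NeZero m] {η : X → ProbabilityMeasure (EuclideanSpace ℝ (Fin d))}
    (hη : ∀ y, ∀ᵐ z ∂(η y : Measure (EuclideanSpace ℝ (Fin d))), z ∈ returnSpace d R γ)
    {ε : ℝ} (hε : 0 ≤ ε) (x : X) :
    (Measure.pi fun _ : Fin m => sampleLaw Q x η) {ω | ε ≤
        ‖(m : ℝ)⁻¹ • ∑ i, Φ (r x + γ • (ω i).2) - ∫ z, Φ z ∂(bellman Q r γ
          (fun y => (η y : Measure (EuclideanSpace ℝ (Fin d)))) x)‖} ≤
      ENNReal.ofReal (2 * Real.exp (-(ε ^ 2 * m / (4 * (γ ^ α * B))))) := by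
  set v := ∫ z, Φ z ∂(bellman Q r γ
    (fun y => (η y : Measure (EuclideanSpace ℝ (Fin d)))) x) with hv
  have hm0 : 0 < m := Nat.pos_of_ne_zero (NeZero.ne m)
  have hm : (0 : ℝ) < m := by exact_mod_cast hm0
  have hmeas : Measurable fun ω : X × EuclideanSpace ℝ (Fin d) => r x + γ • ω.2 := by fun_prop
  have hD2 : 0 < γ ^ α * B := mul_pos (Real.rpow_pos_of_pos hγ0 _) hB0
  set V : X × EuclideanSpace ℝ (Fin d) → H := fun ω => Φ (r x + γ • ω.2) - v with hV
  have hVm : StronglyMeasurable V :=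
    (hc.stronglyMeasurable.comp_measurable hmeas).sub stronglyMeasurable_const
  have hae := ae_sampleLaw_mem_returnSpace (Q := Q) hη x
  have hΦi : Integrable Φ ((sampleLaw Q x η).map fun ω => r x + γ • ω.2) := by
    have := Measure.isProbabilityMeasure_map (μ := sampleLaw Q x η) hmeas.aemeasurable
    refine integrable_feature hα hR hγ1 hc hΦ ((ae_map_iff hmeas.aemeasurable
      (isClosed_returnSpace d R γ).measurableSet).2 ?_)
    filter_upwards [hae] with ω hω using bellman_mem_returnSpace hγ0 hγ1 hr x hω
  have hi : Integrable (fun ω : X × EuclideanSpace ℝ (Fin d) => Φ (r x + γ • ω.2))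
      (sampleLaw Q x η) := (integrable_map_measure hc.aestronglyMeasurable hmeas.aemeasurable).1 hΦi
  have hvi : v = ∫ ω, Φ (r x + γ • ω.2) ∂(sampleLaw Q x η) := by
    rw [hv, ← sampleLaw_map_eq_bellman, integral_map hmeas.aemeasurable hc.aestronglyMeasurable]
  have hV0 : ∫ ω, V ω ∂(sampleLaw Q x η) = 0 := by
    rw [hV, integral_sub hi (integrable_const _), ← hvi]
    simp
  -- All new particles at `x` share the shift `r x` and lie in a `γ`-scaled cube. The resulting
  -- factor `γ ^ α` must be kept: it later absorbs the cost of small `γ`.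
  have hVb : ∀ᵐ ω ∂(sampleLaw Q x η), ‖V ω‖ ≤ √(γ ^ α * B) := by
    filter_upwards [hae] with ω hω
    rw [hV, norm_sub_rev, hvi]
    refine norm_integral_sub_const_le hi ?_
    filter_upwards [hae] with ω' hω'
    refine Real.le_sqrt_of_sq_le ?_
    have := Real.rpow_nonneg hγ0.le α
    rw [norm_feature_affine_sub hγ0 hΦ]
    gcongr
    exact ((Real.le_sqrt (norm_nonneg _) (returnScale_nonneg hR hγ1)).1
      (norm_feature_sub_le hα hR hγ1 hΦ hω' hω)).trans hB
  have hsum : ∀ ω : Fin m → X × EuclideanSpace ℝ (Fin d),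
      (m : ℝ)⁻¹ • ∑ i, Φ (r x + γ • (ω i).2) - v = (m : ℝ)⁻¹ • ∑ i, V (ω i) := fun ω => by
    rw [hV, Finset.sum_sub_distrib, smul_sub]
    congr 1
    rw [Finset.sum_const, Finset.card_univ, Fintype.card_fin, ← Nat.cast_smul_eq_nsmul ℝ, smul_smul,
      inv_mul_cancel₀ hm.ne', one_smul]
  have hmain := measure_norm_sum_ge_le hVm (Real.sqrt_pos.2 hD2) hVb hV0 hm0
    (mul_nonneg hm.le hε)
  rw [Real.sq_sqrt hD2.le] at hmain
  refine (measure_mono fun ω hω => ?_).trans (hmain.trans (le_of_eq ?_))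
  · have hω' : ε ≤ ‖(m : ℝ)⁻¹ • ∑ i, Φ (r x + γ • (ω i).2) - v‖ := hω
    rw [hsum, norm_smul, norm_inv, Real.norm_of_nonneg hm.le, inv_mul_eq_div,
      le_div_iff₀ hm, mul_comm] at hω'
    exact hω'
  · congr 3
    field_simp

/-- Union bound over states. Almost surely all particles stay in the return space, so only the
deviation events count. -/
theorem randBellman_closeRDF_compl_le (hα : 0 < α) (hR : 0 ≤ R) (hγ0 : 0 < γ) (hγ1 : γ < 1)
    (hr : ∀ x i, 0 ≤ r x i ∧ r x i ≤ R) (hc : Continuous Φ)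
    (hΦ : ∀ x y, ‖Φ x - Φ y‖ ^ 2 = ‖x - y‖ ^ α) (hκ : ∀ x y, inner ℝ (Φ x) (Φ y) = κ x y)
    (hκm : Measurable (Function.uncurry κ))
    {B : ℝ} (hB0 : 0 < B) (hB : returnScale d R γ α ≤ B)
    {m : ℕ} [NeZero m] {η : X → ProbabilityMeasure (EuclideanSpace ℝ (Fin d))}
    (hη : ∀ y, ∀ᵐ z ∂(η y : Measure (EuclideanSpace ℝ (Fin d))), z ∈ returnSpace d R γ)
    {ε : ℝ} (hε : 0 ≤ ε) :
    randBellman Q r γ m η (closeRDF R γ κ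
        (bellman Q r γ fun y => (η y : Measure (EuclideanSpace ℝ (Fin d)))) ε)ᶜ ≤
      Fintype.card X * ENNReal.ofReal
        (2 * Real.exp (-(ε ^ 2 * m / (4 * (γ ^ α * B))))) := by
  rw [randBellman_apply, Measure.map_apply (measurable_particleUpdate r γ m)
    (measurableSet_closeRDF hκm _ _).compl]
  set μ := Measure.pi fun x : X => Measure.pi fun _ : Fin m => sampleLaw Q x η with hμ
  set bad : (x : X) → Set (Fin m → X × EuclideanSpace ℝ (Fin d)) := fun x => {ω | ε ≤
        ‖(m : ℝ)⁻¹ • ∑ i, Φ (r x + γ • (ω i).2) - ∫ z, Φ z ∂(bellman Q r γ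
          (fun y => (η y : Measure (EuclideanSpace ℝ (Fin d)))) x)‖} with hbad
  have hbm : ∀ x, MeasurableSet (bad x) := fun x => by
    have h1 : ∀ i, StronglyMeasurable fun ω : Fin m → X × EuclideanSpace ℝ (Fin d) =>
        Φ (r x + γ • (ω i).2) := fun i => hc.stronglyMeasurable.comp_measurable (by fun_prop)
    exact measurableSet_le measurable_const
      (((Finset.stronglyMeasurable_fun_sum _ fun i _ => h1 i).const_smul (m : ℝ)⁻¹).sub
        stronglyMeasurable_const).norm.measurable
  have hae : ∀ᵐ ω ∂μ, ∀ x i, (ω x i).2 ∈ returnSpace d R γ := by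
    rw [ae_all_iff]
    intro x
    rw [ae_all_iff]
    intro i
    have h1 : ∀ᵐ θ ∂(Measure.pi fun _ : Fin m => sampleLaw Q x η),
        (θ i).2 ∈ returnSpace d R γ :=
      (measurePreserving_eval (fun _ : Fin m => sampleLaw Q x η) i).quasiMeasurePreserving.ae
        (ae_sampleLaw_mem_returnSpace hη x)
    exact (measurePreserving_eval
      (fun x : X => Measure.pi fun _ : Fin m => sampleLaw Q x η) x).quasiMeasurePreserving.ae h1
  calc μ ((fun ω x => ewp m fun i => r x + γ • (ω x i).2) ⁻¹' (closeRDF R γ κ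
        (bellman Q r γ fun y => (η y : Measure (EuclideanSpace ℝ (Fin d)))) ε)ᶜ)
      ≤ μ (⋃ x, Function.eval x ⁻¹' bad x) := by
        refine measure_mono_ae ?_
        filter_upwards [hae] with ω hω hω'
        by_contra hcon
        refine hω' fun x => ?_
        have hsupp := ae_ewp_of_forall (isClosed_returnSpace d R γ).measurableSet
          fun i => bellman_mem_returnSpace hγ0 hγ1 hr x (hω x i)
        refine ⟨hsupp, ?_⟩
        have hx : ω x ∉ bad x := fun h => hcon (Set.mem_iUnion.2 ⟨x, h⟩)
        rw [mmd_eq_norm_sub hκ (integrable_feature hα hR hγ1 hc hΦ hsupp)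
          (integrable_feature hα hR hγ1 hc hΦ (ae_bellman_mem_returnSpace hγ0 hγ1 hr hη x)),
          integral_ewp _ hc]
        exact (not_le.1 hx).le
    _ ≤ ∑ x, μ (Function.eval x ⁻¹' bad x) := measure_iUnion_fintype_le _ _
    _ ≤ ∑ _x : X, ENNReal.ofReal
        (2 * Real.exp (-(ε ^ 2 * m / (4 * (γ ^ α * B))))) := by
        refine Finset.sum_le_sum fun x _ => ?_
        rw [hμ, (measurePreserving_eval _ x).measure_preimage (hbm x).nullMeasurableSet]
        exact measure_particle_deviation_le hα hR hγ0 hγ1 hr hc hΦ hB0 hB hη hε x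
    _ = _ := by simp

end Step

/-! ### Iterating the randomized Bellman operator -/

section Iteration

variable {X : Type*} [Fintype X] [MeasurableSpace X] [MeasurableSingletonClass X] {d : ℕ}
  {Q : Kernel X X} [IsMarkovKernel Q] {r : X → EuclideanSpace ℝ (Fin d)} {R γ α : ℝ}
  {H : Type*} [NormedAddCommGroup H] [InnerProductSpace ℝ H] [CompleteSpace H]
  {Φ : EuclideanSpace ℝ (Fin d) → H}
  {κ : EuclideanSpace ℝ (Fin d) → EuclideanSpace ℝ (Fin d) → ℝ}

theorem closeRDF_bellman_subset (hα : 0 < α) (hR : 0 ≤ R) (hγ0 : 0 < γ) (hγ1 : γ < 1)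
    (hr : ∀ x i, 0 ≤ r x i ∧ r x i ≤ R) (hc : Continuous Φ)
    (hΦ : ∀ x y, ‖Φ x - Φ y‖ ^ 2 = ‖x - y‖ ^ α) (hκ : ∀ x y, inner ℝ (Φ x) (Φ y) = κ x y)
    {η : X → ProbabilityMeasure (EuclideanSpace ℝ (Fin d))} {a ε : ℝ}
    (hη : η ∈ closeRDF R γ κ (returnDistribution Q r γ) a) :
    closeRDF R γ κ (bellman Q r γ fun y => (η y : Measure (EuclideanSpace ℝ (Fin d)))) ε ⊆
      closeRDF R γ κ (returnDistribution Q r γ) (γ ^ (α / 2) * a + ε) := by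
  intro ζ hζ x
  refine ⟨(hζ x).1, ?_⟩
  have hrm := measurable_of_finite r
  have hP := isProbabilityMeasure_returnDistribution Q hrm hR hγ0 hγ1 hr
  have hS := ae_returnDistribution_mem_returnSpace Q hrm hR hγ0 hγ1 hr
  have hi : ∀ {p : Measure (EuclideanSpace ℝ (Fin d))} [IsProbabilityMeasure p],
      (∀ᵐ z ∂p, z ∈ returnSpace d R γ) → Integrable Φ p :=
    fun h => integrable_feature hα hR hγ1 hc hΦ h
  have hfix : returnDistribution Q r γ x = bellman Q r γ (returnDistribution Q r γ) x :=
    returnDistribution_eq_sum Q hR hγ0 hγ1 hr x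
  have hηS := fun y => (hη y).1
  have hb := ae_bellman_mem_returnSpace (Q := Q) hγ0 hγ1 hr hηS x
  have h1 := (hζ x).2
  rw [mmd_eq_norm_sub hκ (hi (hζ x).1) (hi hb)] at h1
  have h2 := norm_integral_bellman_sub_le (Q := Q) hα hR hγ0 hγ1 hr hc hΦ hηS hS (a := a)
    (fun y => by
      rw [← mmd_eq_norm_sub hκ (hi (hηS y)) (hi (hS y))]
      exact (hη y).2) x
  rw [mmd_eq_norm_sub hκ (hi (hζ x).1) (hi (hS x)), add_comm]
  conv_lhs => rw [hfix]
  exact (norm_sub_le_norm_sub_add_norm_sub _ _ _).trans (add_le_add h1 h2)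

theorem mem_closeRDF_of_ae_mem (hα : 0 < α) (hR : 0 ≤ R) (hγ0 : 0 < γ) (hγ1 : γ < 1)
    (hr : ∀ x i, 0 ≤ r x i ∧ r x i ≤ R) (hc : Continuous Φ)
    (hΦ : ∀ x y, ‖Φ x - Φ y‖ ^ 2 = ‖x - y‖ ^ α) (hκ : ∀ x y, inner ℝ (Φ x) (Φ y) = κ x y)
    {η : X → ProbabilityMeasure (EuclideanSpace ℝ (Fin d))}
    (hη : ∀ x, ∀ᵐ z ∂(η x : Measure (EuclideanSpace ℝ (Fin d))), z ∈ returnSpace d R γ) :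
    η ∈ closeRDF R γ κ (returnDistribution Q r γ) √(returnScale d R γ α) := by
  intro x
  have hrm := measurable_of_finite r
  have hP := isProbabilityMeasure_returnDistribution Q hrm hR hγ0 hγ1 hr
  have hS := ae_returnDistribution_mem_returnSpace Q hrm hR hγ0 hγ1 hr
  refine ⟨hη x, ?_⟩
  rw [mmd_eq_norm_sub hκ (integrable_feature hα hR hγ1 hc hΦ (hη x))
    (integrable_feature hα hR hγ1 hc hΦ (hS x))]
  exact norm_integral_feature_sub_le hα hR hγ1 hc hΦ (hη x) (hS x)

/-- The level `a_k = β ^ k √B + ε / (1 - β)` satisfies `β a_k + ε = a_{k+1}`. The one-step failure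
bound is uniform over families supported in the return space, so each iteration adds at most `p` to
the failure probability. -/
theorem iterateLaw_closeRDF_compl_le (hα : 0 < α) (hR : 0 ≤ R) (hγ0 : 0 < γ) (hγ1 : γ < 1)
    (hr : ∀ x i, 0 ≤ r x i ∧ r x i ≤ R) (hc : Continuous Φ)
    (hΦ : ∀ x y, ‖Φ x - Φ y‖ ^ 2 = ‖x - y‖ ^ α) (hκ : ∀ x y, inner ℝ (Φ x) (Φ y) = κ x y)
    (hκm : Measurable (Function.uncurry κ)) {B : ℝ} (hB0 : 0 < B)
    (hB : returnScale d R γ α ≤ B) {m : ℕ} [NeZero m]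
    {η₀ : X → ProbabilityMeasure (EuclideanSpace ℝ (Fin d))}
    (hη₀ : ∀ x, ∀ᵐ z ∂(η₀ x : Measure (EuclideanSpace ℝ (Fin d))), z ∈ returnSpace d R γ)
    {ε : ℝ} (hε : 0 ≤ ε) (k : ℕ) :
    iterateLaw Q r γ m η₀ k (closeRDF R γ κ (returnDistribution Q r γ)
        ((γ ^ (α / 2)) ^ k * √B + ε / (1 - γ ^ (α / 2))))ᶜ ≤
      k * (Fintype.card X * ENNReal.ofReal
        (2 * Real.exp (-(ε ^ 2 * m / (4 * (γ ^ α * B)))))) := by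
  have hP := isProbabilityMeasure_returnDistribution Q (measurable_of_finite r) hR hγ0 hγ1 hr
  have hβ1 : γ ^ (α / 2) < 1 := Real.rpow_lt_one hγ0.le hγ1 (by linarith)
  set β := γ ^ (α / 2)
  have hβ : 0 < 1 - β := by linarith
  have hm : ∀ a, MeasurableSet (closeRDF R γ κ (returnDistribution Q r γ) a) := fun a =>
    measurableSet_closeRDF hκm _ a
  set p : ℝ≥0∞ := Fintype.card X * ENNReal.ofReal
        (2 * Real.exp (-(ε ^ 2 * m / (4 * (γ ^ α * B))))) with hp
  induction k with
  | zero =>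
    rw [iterateLaw, Measure.dirac_apply' _ (hm _).compl]
    have : η₀ ∈ closeRDF R γ κ (returnDistribution Q r γ) (β ^ 0 * √B + ε / (1 - β)) := by
      intro x
      have h := mem_closeRDF_of_ae_mem (Q := Q) hα hR hγ0 hγ1 hr hc hΦ hκ hη₀ x
      refine ⟨h.1, h.2.trans ?_⟩
      rw [pow_zero, one_mul]
      exact (Real.sqrt_le_sqrt hB).trans (le_add_of_nonneg_right (by positivity))
    rw [Set.indicator_of_notMem (Set.notMem_compl_iff.2 this)]
    exact zero_le
  | succ k ih =>
    set S := closeRDF R γ κ (returnDistribution Q r γ) (β ^ k * √B + ε / (1 - β)) with hS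
    -- From a bad `η` the failure probability is bounded trivially by `1`, which the indicator
    -- supplies.
    have hstep : ∀ η, randBellman Q r γ m η (closeRDF R γ κ (returnDistribution Q r γ)
        (β ^ (k + 1) * √B + ε / (1 - β)))ᶜ ≤ Sᶜ.indicator 1 η + p := by
      intro η
      by_cases hη : η ∈ S
      · refine le_add_of_le_right (le_trans (measure_mono (Set.compl_subset_compl.2 ?_))
          (randBellman_closeRDF_compl_le hα hR hγ0 hγ1 hr hc hΦ hκ hκm hB0 hB
            (fun y => (hη y).1) hε))
        have : β ^ (k + 1) * √B + ε / (1 - β) = β * (β ^ k * √B + ε / (1 - β)) + ε := by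
          field_simp
          ring
        rw [this]
        exact closeRDF_bellman_subset hα hR hγ0 hγ1 hr hc hΦ hκ hη
      · have : η ∈ Sᶜ := hη
        rw [Set.indicator_of_mem this]
        exact prob_le_one.trans le_self_add
    rw [iterateLaw, Measure.bind_apply (hm _).compl (Kernel.aemeasurable _)]
    calc _ ≤ ∫⁻ η, (Sᶜ.indicator 1 η + p) ∂(iterateLaw Q r γ m η₀ k) := lintegral_mono hstep
      _ = iterateLaw Q r γ m η₀ k Sᶜ + p := by
        rw [lintegral_add_right _ measurable_const, lintegral_indicator_one (hm _).compl,
          lintegral_const, measure_univ, mul_one]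
      _ ≤ k * p + p := by gcongr
      _ = _ := by push_cast; ring

end Iteration

/-! ### The error bound -/

section ErrorBound

variable {N m : ℕ} {γ α δ : ℝ}

theorem log_rpow_neg_pos (hγ0 : 0 < γ) (hγ1 : γ < 1) (hα : 0 < α) :
    0 < Real.log (γ ^ (-α)) := by
  rw [Real.log_rpow hγ0]
  nlinarith [Real.log_neg hγ0 hγ1]

theorem rpow_half_eq_exp (hγ0 : 0 < γ) :
    γ ^ (α / 2) = Real.exp (-(Real.log (γ ^ (-α)) / 2)) := by
  rw [Real.log_rpow hγ0, Real.rpow_def_of_pos hγ0]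
  ring_nf

theorem pow_numIterations_le (hγ0 : 0 < γ) (hγ1 : γ < 1) (hα : 0 < α) (hm : 0 < m) :
    (γ ^ (α / 2)) ^ numIterations m γ α ≤ 1 / √m := by
  have hL := log_rpow_neg_pos hγ0 hγ1 hα
  have hm' : (0 : ℝ) < m := by exact_mod_cast hm
  have hK : Real.log m ≤ numIterations m γ α * Real.log (γ ^ (-α)) :=
    (div_le_iff₀ hL).1 (Nat.le_ceil _)
  rw [rpow_half_eq_exp hγ0, ← Real.exp_nat_mul, ← Real.exp_log (Real.sqrt_pos.2 hm'), one_div,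
    ← Real.exp_neg, Real.exp_le_exp, Real.log_sqrt hm'.le]
  linarith

/-- Write `L = log γ^{-α}`. Since `K L ≤ log m + L`, replacing `K` by `1 / L` inside the logarithm
costs at most `log m + L`. The term `L` is unbounded as `γ → 0`, but the prefactor is `exp(-L / 2)`
and `L exp(-L / 2) ≤ 2`; then `W + 2 ≤ 3 W`. -/
theorem rpow_half_mul_sqrt_log_le (hγ0 : 0 < γ) (hγ1 : γ < 1) (hα : 0 < α) (hN : 0 < N)
    (hm : 0 < m) (hδ : 0 < δ) (hK : 0 < numIterations m γ α) :
    γ ^ (α / 2) * √(Real.log (2 * N * numIterations m γ α / δ)) ≤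
      3 * (max 1 (Real.log (N * δ⁻¹ / Real.log (γ ^ (-α)))) + Real.log m) := by
  have hL := log_rpow_neg_pos hγ0 hγ1 hα
  have hN' : (0 : ℝ) < N := by exact_mod_cast hN
  have hK' : (0 : ℝ) < numIterations m γ α := by exact_mod_cast hK
  have hm' : (1 : ℝ) ≤ m := by exact_mod_cast hm
  have hlm : 0 ≤ Real.log m := Real.log_nonneg hm'
  have hKle : (numIterations m γ α : ℝ) ≤ Real.log m / Real.log (γ ^ (-α)) + 1 :=
    (Nat.ceil_lt_add_one (by positivity)).le
  rw [rpow_half_eq_exp hγ0]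
  set L := Real.log (γ ^ (-α))
  set K : ℝ := (numIterations m γ α : ℝ)
  set W := max 1 (Real.log (N * δ⁻¹ / L)) + Real.log m with hW
  have hW1 : 1 ≤ W := le_add_of_le_of_nonneg (le_max_left _ _) hlm
  have hKL : K * L ≤ Real.log m + L := by
    calc K * L ≤ (Real.log m / L + 1) * L := by gcongr
      _ = _ := by field_simp
  have hlog : Real.log (2 * N * K / δ) ≤ W + L := by
    have e : 2 * N * K / δ = (N * δ⁻¹ / L) * (2 * (K * L)) / 1 := by field_simp
    have hlog2 : Real.log (2 * (K * L)) ≤ K * L := by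
      rw [Real.log_mul two_ne_zero (by positivity)]
      have h1 := Real.log_le_sub_one_of_pos (x := K * L) (by positivity)
      have h2 := Real.log_two_lt_d9
      linarith
    rw [e, div_one, Real.log_mul (by positivity) (by positivity)]
    have := le_max_right 1 (Real.log (N * δ⁻¹ / L))
    linarith
  -- The square root may be dropped because `W + L ≥ 1`.
  have hsq : √(Real.log (2 * N * K / δ)) ≤ W + L := by
    refine Real.sqrt_le_iff.2 ⟨by linarith, ?_⟩
    nlinarith
  have he1 : Real.exp (-(L / 2)) ≤ 1 := Real.exp_le_one_iff.2 (by linarith)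
  have he2 : Real.exp (-(L / 2)) * L ≤ 2 := by
    rw [Real.exp_neg, inv_mul_le_iff₀ (Real.exp_pos _)]
    have := Real.add_one_le_exp (L / 2)
    linarith
  have he0 := Real.exp_pos (-(L / 2))
  calc Real.exp (-(L / 2)) * √(Real.log (2 * N * K / δ)) ≤ Real.exp (-(L / 2)) * (W + L) := by
        gcongr
    _ ≤ 3 * W := by nlinarith

theorem exists_step_error (hγ0 : 0 < γ) (hγ1 : γ < 1) (hα : 0 < α) (hN : 0 < N) (hm : 0 < m)
    (hδ0 : 0 < δ) (hδ1 : δ < 1) {B : ℝ} (hB : 0 < B) : ∃ ε : ℝ, 0 ≤ ε ∧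
      (numIterations m γ α : ℝ≥0∞) * (N * ENNReal.ofReal
        (2 * Real.exp (-(ε ^ 2 * m / (4 * (γ ^ α * B)))))) ≤ ENNReal.ofReal δ ∧
      (γ ^ (α / 2)) ^ numIterations m γ α * √B + ε / (1 - γ ^ (α / 2)) ≤
        7 * √B * errorFactor N m γ α δ := by
  have hβ1 : γ ^ (α / 2) < 1 := Real.rpow_lt_one hγ0.le hγ1 (by linarith)
  have hβ0 : 0 < γ ^ (α / 2) := Real.rpow_pos_of_pos hγ0 _
  have hβ2 : γ ^ α = (γ ^ (α / 2)) ^ 2 := by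
    rw [← Real.rpow_natCast, ← Real.rpow_mul hγ0.le]
    ring_nf
  have hm' : (1 : ℝ) ≤ m := by exact_mod_cast hm
  have hN' : (1 : ℝ) ≤ N := by exact_mod_cast hN
  have hsm : 0 < √(m : ℝ) := Real.sqrt_pos.2 (by linarith)
  have hlm : 0 ≤ Real.log m := Real.log_nonneg hm'
  have hW1 : 1 ≤ max 1 (Real.log (N * δ⁻¹ / Real.log (γ ^ (-α)))) + Real.log m :=
    le_add_of_le_of_nonneg (le_max_left _ _) hlm
  have hpow := pow_numIterations_le hγ0 hγ1 hα hm
  have hlog := fun hK => rpow_half_mul_sqrt_log_le (δ := δ) hγ0 hγ1 hα hN hm hδ0 hK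
  rw [hβ2]
  unfold errorFactor
  set W := max 1 (Real.log (N * δ⁻¹ / Real.log (γ ^ (-α)))) + Real.log m
  set K := numIterations m γ α
  set β := γ ^ (α / 2)
  have h1β : 0 < 1 - β := by linarith
  have hfirst : β ^ K * √B ≤ √B * W / ((1 - β) * √m) := by
    calc β ^ K * √B ≤ 1 / √m * √B := by gcongr
      _ = √B * 1 / (1 * √m) := by ring
      _ ≤ √B * W / ((1 - β) * √m) := by
        gcongr
        linarith
  have hW7 : 0 ≤ √B * W / ((1 - β) * √m) := by positivity
  rcases Nat.eq_zero_or_pos K with hK | hK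
  -- No iteration is made (this is `m = 1`), so there is no sampling error.
  · refine ⟨0, le_rfl, by simp [hK], ?_⟩
    rw [zero_div, add_zero]
    refine hfirst.trans ?_
    have : 7 * √B * (W / ((1 - β) * √m)) = 7 * (√B * W / ((1 - β) * √m)) := by ring
    rw [this]
    linarith
  · have hK' : (1 : ℝ) ≤ K := by exact_mod_cast hK
    set ℓ := Real.log (2 * N * K / δ) with hℓ
    have harg : 1 ≤ 2 * N * K / δ := by
      rw [le_div_iff₀ hδ0]
      nlinarith
    have hℓ0 : 0 ≤ ℓ := Real.log_nonneg harg
    -- This `ε` solves `2 N K exp(-ε² m / (4 β² B)) = δ`.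
    refine ⟨2 * β * √B * √ℓ / √m, by positivity, ?_, ?_⟩
    · have e : (2 * β * √B * √ℓ / √m) ^ 2 * m / (4 * (β ^ 2 * B)) = ℓ := by
        rw [div_pow, mul_pow, mul_pow, mul_pow, Real.sq_sqrt hB.le, Real.sq_sqrt hℓ0,
          Real.sq_sqrt (by linarith)]
        field_simp
        ring
      rw [e, Real.exp_neg, hℓ, Real.exp_log (by linarith), ← ENNReal.ofReal_natCast,
        ← ENNReal.ofReal_natCast N, ← ENNReal.ofReal_mul (by positivity),
        ← ENNReal.ofReal_mul (by positivity)]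
      refine ENNReal.ofReal_le_ofReal (le_of_eq ?_)
      field_simp
    · have h2 : 2 * β * √B * √ℓ / √m / (1 - β) ≤ 6 * (√B * W / ((1 - β) * √m)) := by
        calc 2 * β * √B * √ℓ / √m / (1 - β) = 2 * √B * (β * √ℓ) / ((1 - β) * √m) := by
              field_simp
          _ ≤ 2 * √B * (3 * W) / ((1 - β) * √m) := by
              have := hlog hK
              gcongr
          _ = _ := by ring
      have : 7 * √B * (W / ((1 - β) * √m)) = 7 * (√B * W / ((1 - β) * √m)) := by ring
      rw [this]
      linarith

end ErrorBound

end MultiReturn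

end

/-! ### Assembling the three bounds. -/

theorem mainTheorem2 :
    ∃ C : ℝ, 0 < C ∧
      ∀ (X A : Type*) [Fintype X] [Nonempty X] [MeasurableSpace X] [MeasurableSingletonClass X]
        [MeasurableSpace A]
        (P : Kernel (X × A) X) [IsMarkovKernel P] (π : Kernel X A) [IsMarkovKernel π]
        (d : ℕ) (R γ α δ : ℝ) (_ : 0 ≤ R) (_ : 0 < γ) (_ : γ < 1) (_ : 0 < α) (_ : α < 2)
        (_ : 0 < δ)
        (r : X → EuclideanSpace ℝ (Fin d)) (_ : ∀ x i, 0 ≤ r x i ∧ r x i ≤ R)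
        (y₀ : EuclideanSpace ℝ (Fin d))
        (m : ℕ) [NeZero m]
        (η₀ : X → ProbabilityMeasure (EuclideanSpace ℝ (Fin d)))
        (_ : ∀ x, ∀ᵐ z ∂(η₀ x : Measure (EuclideanSpace ℝ (Fin d))), z ∈ returnSpace d R γ),
        1 - ENNReal.ofReal δ ≤
          iterateLaw (policyKernel P π) r γ m η₀ (numIterations m γ α)
            {η |
              let M : ℝ := supMMD (inducedKernel (energySemimetric α) y₀)
                (fun x => (η x : Measure (EuclideanSpace ℝ (Fin d))))
                (returnDistribution (policyKernel P π) r γ)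
              M ≤ C * √(returnScale d R γ α) * errorFactor (Fintype.card X) m γ α δ ∧
              (1 - γ ≤ √d * R →
                M ≤ C * returnScale d R γ α * errorFactor (Fintype.card X) m γ α δ) ∧
              M ^ 2 ≤ C * returnScale d R γ α * errorFactor (Fintype.card X) m γ α δ} := by
  -- `7 = 1 + 6`: one unit for the initial error `β ^ K √B`, six for the accumulated sampling error.
  refine ⟨7, by norm_num, ?_⟩
  intro X A _ _ _ _ _ P _ π _ d R γ α δ hR hγ0 hγ1 hα hα2 hδ r hr y₀ m _ η₀ hη₀
  rcases le_or_gt 1 δ with hδ1 | hδ1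
  · rw [tsub_eq_zero_of_le (by simpa using ENNReal.ofReal_le_ofReal hδ1)]
    exact zero_le
  obtain ⟨Φ, hc, hκ, hΦ⟩ := exists_feature_inner hα hα2 y₀
  set Q := policyKernel P π
  have hm0 : 0 < m := Nat.pos_of_ne_zero (NeZero.ne m)
  have hκm := measurable_inducedKernel_energySemimetric (α := α) y₀
  have hP := isProbabilityMeasure_returnDistribution Q (measurable_of_finite r) hR hγ0 hγ1 hr
  set B := returnScale d R γ α with hB
  have hB0 : 0 ≤ B := returnScale_nonneg hR hγ1
  obtain ⟨B', hB', hBB', hBeq⟩ : ∃ B' : ℝ, 0 < B' ∧ B ≤ B' ∧ (0 < B → B' = B) := by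
    rcases hB0.eq_or_lt with h | h
    · exact ⟨1, one_pos, by linarith, fun h' => absurd h' (by linarith)⟩
    · exact ⟨B, h, le_rfl, fun _ => rfl⟩
  obtain ⟨ε, hε, hprob, hbound⟩ := exists_step_error hγ0 hγ1 hα (Fintype.card_pos (α := X)) hm0
    hδ hδ1 hB'
  have hiter := (iterateLaw_closeRDF_compl_le (Q := Q) hα hR hγ0 hγ1 hr hc hΦ hκ hκm hB' hBB'
    hη₀ hε (numIterations m γ α)).trans hprob
  have hmeas := measurableSet_closeRDF (R := R) (γ := γ) hκm (returnDistribution Q r γ)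
    ((γ ^ (α / 2)) ^ numIterations m γ α * √B' + ε / (1 - γ ^ (α / 2)))
  rw [prob_compl_eq_one_sub hmeas] at hiter
  refine le_trans (tsub_le_iff_tsub_le.1 hiter) (measure_mono fun η hη => ?_)
  have hΛ : 0 ≤ errorFactor (Fintype.card X) m γ α δ := by
    have hβ1 : γ ^ (α / 2) < 1 := Real.rpow_lt_one hγ0.le hγ1 (by linarith)
    have hlm : 0 ≤ Real.log m := Real.log_natCast_nonneg m
    refine div_nonneg (add_nonneg (zero_le_one.trans (le_max_left _ _)) hlm)
      (mul_nonneg (by linarith) (Real.sqrt_nonneg _))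
  set Λ := errorFactor (Fintype.card X) m γ α δ
  set M : ℝ := supMMD (inducedKernel (energySemimetric α) y₀)
    (fun x => (η x : Measure (EuclideanSpace ℝ (Fin d)))) (returnDistribution Q r γ)
  change M ≤ 7 * √B * Λ ∧ (1 - γ ≤ √d * R → M ≤ 7 * B * Λ) ∧ M ^ 2 ≤ 7 * B * Λ
  have hM0 : 0 ≤ M := Real.iSup_nonneg fun x => Real.sqrt_nonneg _
  -- Deterministic bound by the feature diameter; it settles `B = 0` and supplies the second factor
  -- for `M ^ 2`.
  have hMB : M ≤ √B := ciSup_le fun x =>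
    (mem_closeRDF_of_ae_mem (Q := Q) hα hR hγ0 hγ1 hr hc hΦ hκ (fun x => (hη x).1) x).2
  have hM1 : M ≤ 7 * √B * Λ := by
    rcases hB0.eq_or_lt with h | h
    · rw [← h] at hMB ⊢
      simpa using hMB
    · rw [hBeq h] at hη hbound
      exact (ciSup_le fun x => (hη x).2).trans hbound
  refine ⟨hM1, fun h => hM1.trans ?_, ?_⟩
  · have h1γ : 0 < 1 - γ := by linarith
    have hB1 : 1 ≤ B := by
      rw [hB, returnScale_eq hR hγ1]
      refine Real.one_le_rpow ?_ hα.le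
      rw [← mul_div_assoc, le_div_iff₀ h1γ]
      linarith
    have : √B ≤ B := Real.sqrt_le_iff.2 ⟨hB0, by nlinarith⟩
    gcongr
  · calc M ^ 2 = M * M := sq M
      _ ≤ √B * (7 * √B * Λ) := by gcongr
      _ = 7 * (√B * √B) * Λ := by ring
      _ = 7 * B * Λ := by rw [Real.mul_self_sqrt hB0]
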